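/- Let $\beta\in\{2,4\}$, $m\ge 1$ an integer, and $\mathcal T>0$. For $0\le \nu\le q$, $0\le n\le p$ let $$G^{\nu,n}_{p,q}\Big({a_1,\dots,a_p\atop b_1,\dots,b_q}\Big|\,x\Big)=\frac1{2\pi i}\int_L x^s\,\frac{\prod_{j=1}^{\nu}\Gamma(b_j-s)\prod_{j=1}^{n}\Gamma(1-a_j+s)}{\prod_{j=\nu+1}^{q}\Gamma(1-b_j+s)\prod_{j=n+1}^{p}\Gamma(a_j-s)}\,ds$$ be the Meijer $G$-function, where $L$ is an upward vertical line with the poles of $\Gamma(b_j-s)$, $j\le \nu$, to its right and those of $\Gamma(1-a_j+s)$, $j\le n$, to its left. Let $\boldsymbol{k}=(k,\dots,k)$ denote a vector of length $m$. For $N\ge1$ set $$Q_N(z)=-\frac1N\log G^{m,0}_{0,m}\Big({-\atop \boldsymbol{0}}\Big|\Big(\frac{\beta N}{2}\Big)^m|z|^2\Big),$$ the potential of the product of $m$ complex ($\beta=2$) or quaternionic ($\beta=4$) Ginibre matrices of size $N$. Let $z_1,\dots,z_N\in\mathbb C$ have the joint density, with respect to $\prod_j dA(z_j)$, $dA=\pi^{-1}d^2z$,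 given by $$\frac1{Z_N}\prod_{j>k}|z_j-z_k|^2\prod_{j}e^{-NQ_N(z_j)}\quad(\beta=2),\qquad \frac1{Z_N}\prod_{j>k}|z_j-z_k|^2|z_j-\bar z_k|^2\prod_j|z_j-\bar z_j|^2e^{-NQ_N(z_j)}\quad(\beta=4),$$ where $Z_N$ is the normalising constant. Let $E_N^{(\beta)}(a)$ and $V_N^{(\beta)}(a)$ be the mean and the variance of the number of indices $j$ with $|z_j|<a$. Then these densities define probability measures for all $N\ge 1$, and, with convergent series, $$\lim_{N\to\infty}E_N^{(\beta)}\Big(\frac{\mathcal T}{N^{m/2}}\Big)=\sum_{j=1}^\infty\frac1{(\frac\beta2 j-1)!^{m}}\,G^{m,1}_{1,m+1}\Big({1\atop \boldsymbol{\tfrac\beta2 j},0}\Big|\Big(\frac\beta2\Big)^m\mathcal T^2\Big),$$ $$\lim_{N\to\infty}V_N^{(\beta)}\Big(\frac{\mathcal T}{N^{m/2}}\Big)=\sum_{j=1}^\infty\frac1{(\frac\beta2 j-1)!^{2m}}\,G^{m,1}_{1,m+1}\Big({1\atop \boldsymbol{\tfrac\beta2 j},0}\Big|\Big(\frac\beta2\Big)^m\mathcal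 T^2\Big)\,G^{m+1,0}_{1,m+1}\Big({1\atop 0,\boldsymbol{\tfrac\beta2 j}}\Big|\Big(\frac\beta2\Big)^m\mathcal T^2\Big).$$ -/

import Mathlib

open MeasureTheory ProbabilityTheory Filter Topology

noncomputable section

namespace PlanarEnsemble

/-! ### The Meijer G-function -/

/-- The Mellin-Barnes integrand of `G^{m,n}_{p,q}(a; b | z)`:
`z^s ∏_{j ≤ m} Γ(b_j - s) ∏_{j ≤ n} Γ(1 - a_j + s)`
divided by `∏_{m < j ≤ q} Γ(1 - b_j + s) ∏_{n < j ≤ p} Γ(a_j - s)`.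
(The first index of the vectors is `0` here, so `j ≤ m` reads `j < m`. The function `(Γ w)⁻¹` of
Mathlib is the entire function `1 / Γ`, zero at the poles of `Γ`.) -/
def meijerIntegrand (m n : ℕ) {p q : ℕ} (a : Fin p → ℂ) (b : Fin q → ℂ) (z s : ℂ) : ℂ :=
  z ^ s
    * (∏ j : Fin q,
        if (j : ℕ) < m then Complex.Gamma (b j - s) else (Complex.Gamma (1 - b j + s))⁻¹)
    * (∏ j : Fin p,
        if (j : ℕ) < n then Complex.Gamma (1 - a j + s) else (Complex.Gamma (a j - s))⁻¹)

/-- The vertical line `Re s = c` has all the poles `b_j + ℓ` (`j ≤ m`, `ℓ ≥ 0`) of the functions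
`Γ(b_j - s)` to its right and all the poles `a_j - 1 - ℓ` (`j ≤ n`, `ℓ ≥ 0`) of the functions
`Γ(1 - a_j + s)` to its left. -/
def Separates (m n : ℕ) {p q : ℕ} (a : Fin p → ℂ) (b : Fin q → ℂ) (c : ℝ) : Prop :=
  (∀ j : Fin q, (j : ℕ) < m → c < (b j).re) ∧ (∀ j : Fin p, (j : ℕ) < n → (a j).re - 1 < c)

open Classical in
/-- The Meijer G-function `G^{m,n}_{p,q}(a; b | z) = (2πi)⁻¹ ∫_L (integrand) ds`, the contour `L`
being a vertical line, directed upwards, that separates the two families of poles. By Cauchy's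
theorem the choice of the line is immaterial. This covers all parameters for which a separating line
exists, with `|arg z| < (m + n - (p + q) / 2) π`, which is the range of absolute convergence.
With `s = c + i t`, one has `(2πi)⁻¹ ds = (2π)⁻¹ dt`. -/
def meijerG (m n : ℕ) {p q : ℕ} (a : Fin p → ℂ) (b : Fin q → ℂ) (z : ℂ) : ℂ :=
  if h : ∃ c : ℝ, Separates m n a b c then
    (2 * (Real.pi : ℂ))⁻¹ *
      ∫ t : ℝ, meijerIntegrand m n a b z ((h.choose : ℂ) + (t : ℂ) * Complex.I)
  else 0

/-! ### Planar complex and symplectic ensembles -/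

/-- The two symmetry classes: complex (`β = 2`) and symplectic, or quaternionic (`β = 4`). -/
inductive SymmetryClass
  | complex
  | symplectic

/-- The Dyson index `β`. -/
def SymmetryClass.beta : SymmetryClass → ℕ
  | .complex => 2
  | .symplectic => 4

/-- The normalised area measure `dA = π⁻¹ d²z` on `ℂ`. -/
def areaMeasure : Measure ℂ := ENNReal.ofReal (Real.pi⁻¹) • (volume : Measure ℂ)

/-- The interaction factor of the joint density:
`∏_{j > k} |z_j - z_k|²` for `β = 2`, and
`∏_{j > k} |z_j - z_k|² |z_j - conj z_k|² ∏_j |z_j - conj z_j|²` for `β = 4`. -/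
def interaction (σ : SymmetryClass) {N : ℕ} (z : Fin N → ℂ) : ℝ :=
  match σ with
  | .complex => ∏ j : Fin N, ∏ k ∈ Finset.Iio j, ‖z j - z k‖ ^ 2
  | .symplectic =>
      (∏ j : Fin N, ∏ k ∈ Finset.Iio j,
          ‖z j - z k‖ ^ 2 * ‖z j - (starRingEnd ℂ) (z k)‖ ^ 2)
        * ∏ j : Fin N, ‖z j - (starRingEnd ℂ) (z j)‖ ^ 2

/-- The unnormalised joint density of `N` points in the external potential `Q`. -/
def jointWeight (σ : SymmetryClass) (N : ℕ) (Q : ℂ → ℝ) (z : Fin N → ℂ) : ℝ :=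
  interaction σ z * ∏ j : Fin N, Real.exp (-((N : ℝ) * Q (z j)))

/-- The partition function `Z_N`. -/
def partitionFunction (σ : SymmetryClass) (N : ℕ) (Q : ℂ → ℝ) : ℝ :=
  ∫ z, jointWeight σ N Q z ∂(Measure.pi fun _ : Fin N => areaMeasure)

/-- The joint law of the `N` points in the external potential `Q`. -/
def gibbsMeasure (σ : SymmetryClass) (N : ℕ) (Q : ℂ → ℝ) : Measure (Fin N → ℂ) :=
  (Measure.pi fun _ : Fin N => areaMeasure).withDensity
    fun z => ENNReal.ofReal (jointWeight σ N Q z / partitionFunction σ N Q)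

open Classical in
/-- The number of points in the open disc of radius `a` centred at the origin. -/
def pointCount {N : ℕ} (a : ℝ) (z : Fin N → ℂ) : ℝ :=
  ((Finset.univ.filter fun j : Fin N => ‖z j‖ < a).card : ℝ)

/-- The expected number `E_N(a)` of points in the disc of radius `a`. -/
def meanNumber (σ : SymmetryClass) (N : ℕ) (Q : ℂ → ℝ) (a : ℝ) : ℝ :=
  ∫ z, pointCount a z ∂(gibbsMeasure σ N Q)

/-- The number variance `V_N(a)`. -/
def numberVariance (σ : SymmetryClass) (N : ℕ) (Q : ℂ → ℝ) (a : ℝ) : ℝ :=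
  variance (fun z : Fin N → ℂ => pointCount a z) (gibbsMeasure σ N Q)

/-! ### Products of Ginibre matrices -/

/-- The potential of the product of `m` Ginibre matrices of size `N`,
`Q_N(z) = - (1/N) log G^{m,0}_{0,m}(-; 0,…,0 | (β N / 2)^m |z|²)`.
The G-function is real and positive for a positive argument; the value at the single point `z = 0`
is immaterial. -/
def productPotential (σ : SymmetryClass) (m N : ℕ) (z : ℂ) : ℝ :=
  -(1 / (N : ℝ)) * Real.log
    (meijerG m 0 (fun i : Fin 0 => i.elim0) (fun _ : Fin m => (0 : ℂ))
      (((((σ.beta : ℝ) / 2 * N) ^ m * ‖z‖ ^ 2 : ℝ)) : ℂ)).re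

/-- `G^{m,1}_{1,m+1}(1; k,…,k, 0 | x)`, with `k` repeated `m` times. -/
def meijerLower (m k : ℕ) (x : ℝ) : ℂ :=
  meijerG m 1 (fun _ : Fin 1 => (1 : ℂ))
    (Fin.snoc (α := fun _ => ℂ) (fun _ : Fin m => (k : ℂ)) 0) (x : ℂ)

/-- `G^{m+1,0}_{1,m+1}(1; 0, k,…,k | x)`, with `k` repeated `m` times. -/
def meijerUpper (m k : ℕ) (x : ℝ) : ℂ :=
  meijerG (m + 1) 0 (fun _ : Fin 1 => (1 : ℂ))
    (Fin.cons (α := fun _ => ℂ) 0 (fun _ : Fin m => (k : ℂ))) (x : ℂ)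

end PlanarEnsemble

end

/-!
The interaction, expanded by the Leibniz formula, is a finite sum of monomials in the `z j` and
their conjugates. Against a product of rotation-invariant weights `φ (|z j|)` only the monomials
`∏ |z j| ^ (2 * d j)` survive, with `d` a rearrangement of the exponents `(β / 2) j - 1`,
`j = 1, …, N`, so the integral is the product of the radial moments of `φ` of these orders, up to a
constant that does not depend on `φ`. Multiplying `φ` by `exp t` on the disc of radius `a` turns
this into the moment generating function of the number of points in the disc: it is the one of a
sum of independent Bernoulli variables.

For the product potential, the `j`-th success probability at `a = T / N ^ (m / 2)` is the
probability that a product of `m` independent Gamma variables with shape parameter `(β / 2) j` is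
less than `(β / 2) ^ m T ^ 2`. It does not depend on `N`, so the mean and the variance are partial
sums of the limiting series. The Mellin transforms of this distribution function and of its
complement are Gamma products divided by `s`, and Mellin inversion identifies both functions with
Meijer G-functions.
-/

namespace PlanarEnsemble

open Set
open scoped ComplexConjugate

/-! ### Multiplicative convolution and Mellin transforms -/

section MulConv

variable {𝕜 : Type*} [RCLike 𝕜] {f h : ℝ → 𝕜} {C x : ℝ}

/-- The multiplicative convolution `∫₀^∞ f (x / t) h t dt / t` of two functions on `(0, ∞)`. If `f`
and `h` are the densities of two independent positive random variables, it is the density of their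
product. -/
noncomputable def mulConv (f h : ℝ → 𝕜) (x : ℝ) : 𝕜 := ∫ t in Ioi (0 : ℝ), f (x / t) * h t / (t : 𝕜)

theorem mulConv_ofReal (f h : ℝ → ℝ) (x : ℝ) :
    mulConv (fun t => (f t : 𝕜)) (fun t => (h t : 𝕜)) x = ((mulConv f h x : ℝ) : 𝕜) := by
  simp only [mulConv, ← integral_ofReal, RCLike.ofReal_mul, RCLike.ofReal_div,
    RCLike.ofReal_real_eq_id, id_eq]

theorem integral_Ioi_comp_div_mul_div (f h : ℝ → 𝕜) {t : ℝ} (ht : 0 < t) :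
    ∫ x in Ioi (0 : ℝ), f (x / t) * h t / (t : 𝕜) = (∫ x in Ioi (0 : ℝ), f x) * h t := by
  have ht' : (t : 𝕜) ≠ 0 := RCLike.ofReal_ne_zero.2 ht.ne'
  simp only [mul_div_assoc, integral_mul_const, div_eq_mul_inv _ t]
  rw [integral_comp_mul_right_Ioi f 0 (inv_pos.2 ht), zero_mul, inv_inv,
    RCLike.real_smul_eq_coe_mul]
  field_simp

theorem integrable_mulConv_kernel (mf : Measurable f) (mh : Measurable h)
    (hf : IntegrableOn f (Ioi 0)) (hh : IntegrableOn h (Ioi 0)) :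
    Integrable (fun p : ℝ × ℝ => f (p.1 / p.2) * h p.2 / (p.2 : 𝕜))
      ((volume.restrict (Ioi 0)).prod (volume.restrict (Ioi 0))) := by
  have hmeas : Measurable fun p : ℝ × ℝ => f (p.1 / p.2) * h p.2 / (p.2 : 𝕜) := by
    have : Measurable fun t : ℝ => (t : 𝕜) := RCLike.measurable_ofReal
    fun_prop
  rw [integrable_prod_iff' hmeas.aestronglyMeasurable]
  refine ⟨ae_restrict_of_forall_mem measurableSet_Ioi fun t ht => ?_, ?_⟩
  · have hslice : IntegrableOn (fun x => f (x * t⁻¹)) (Ioi 0) := by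
      simpa using (integrableOn_Ioi_comp_mul_right_iff f 0 (inv_pos.2 ht)).2 (by simpa using hf)
    simpa only [div_eq_mul_inv, mul_assoc] using hslice.mul_const (h t / (t : 𝕜))
  · refine (hh.norm.const_mul (∫ x in Ioi (0 : ℝ), ‖f x‖)).congr ?_
    refine ae_restrict_of_forall_mem measurableSet_Ioi fun t ht => ?_
    have habs : |t| = t := abs_of_pos ht
    simpa [habs] using (integral_Ioi_comp_div_mul_div (‖f ·‖) (‖h ·‖) ht).symm

theorem integrableOn_mulConv (mf : Measurable f) (mh : Measurable h)
    (hf : IntegrableOn f (Ioi 0)) (hh : IntegrableOn h (Ioi 0)) :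
    IntegrableOn (mulConv f h) (Ioi 0) :=
  (integrable_mulConv_kernel mf mh hf hh).integral_prod_left

theorem integral_mulConv (mf : Measurable f) (mh : Measurable h)
    (hf : IntegrableOn f (Ioi 0)) (hh : IntegrableOn h (Ioi 0)) :
    ∫ x in Ioi (0 : ℝ), mulConv f h x =
      (∫ x in Ioi (0 : ℝ), f x) * ∫ x in Ioi (0 : ℝ), h x := by
  simp only [mulConv]
  rw [integral_integral_swap (integrable_mulConv_kernel mf mh hf hh), ← integral_const_mul]
  exact setIntegral_congr_fun measurableSet_Ioi fun t ht => integral_Ioi_comp_div_mul_div f h ht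

theorem measurable_mulConv (mf : Measurable f) (mh : Measurable h) : Measurable (mulConv f h) := by
  have : Measurable fun t : ℝ => (t : 𝕜) := RCLike.measurable_ofReal
  have hmeas : StronglyMeasurable
      (Function.uncurry fun x t : ℝ => f (x / t) * h t / (t : 𝕜)) := by
    refine Measurable.stronglyMeasurable ?_
    simp only [Function.uncurry_def]
    fun_prop
  exact hmeas.integral_prod_right.measurable

theorem norm_comp_div_mul_div_le (hC : ∀ x > 0, ‖f x‖ ≤ C / x) (h : ℝ → 𝕜) (hx : 0 < x) {t : ℝ}
    (ht : 0 < t) : ‖f (x / t) * h t / (t : 𝕜)‖ ≤ C / x * ‖h t‖ := by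
  rw [norm_div, norm_mul, RCLike.norm_ofReal, abs_of_pos ht]
  calc ‖f (x / t)‖ * ‖h t‖ / t ≤ C / (x / t) * ‖h t‖ / t := by
        gcongr
        exact hC _ (div_pos hx ht)
    _ = C / x * ‖h t‖ := by field_simp

theorem integrableOn_comp_div_mul_div (mf : Measurable f) (hC : ∀ x > 0, ‖f x‖ ≤ C / x)
    (mh : Measurable h) (hh : IntegrableOn h (Ioi 0)) (hx : 0 < x) :
    IntegrableOn (fun t : ℝ => f (x / t) * h t / (t : 𝕜)) (Ioi 0) := by
  have : Measurable fun t : ℝ => (t : 𝕜) := RCLike.measurable_ofReal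
  exact (hh.norm.const_mul (C / x)).mono' (by fun_prop : Measurable _).aestronglyMeasurable
    (ae_restrict_of_forall_mem measurableSet_Ioi fun t => norm_comp_div_mul_div_le hC h hx)

theorem norm_mulConv_le (hC : ∀ x > 0, ‖f x‖ ≤ C / x) (hh : IntegrableOn h (Ioi 0)) (hx : 0 < x) :
    ‖mulConv f h x‖ ≤ C / x * ∫ t in Ioi (0 : ℝ), ‖h t‖ := by
  rw [← integral_const_mul]
  exact norm_integral_le_of_norm_le (hh.norm.const_mul _)
    (ae_restrict_of_forall_mem measurableSet_Ioi fun t => norm_comp_div_mul_div_le hC h hx)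

theorem continuousOn_mulConv (mf : Measurable f) (hC : ∀ x > 0, ‖f x‖ ≤ C / x)
    (hf : ContinuousOn f (Ioi 0)) (mh : Measurable h) (hh : IntegrableOn h (Ioi 0)) :
    ContinuousOn (mulConv f h) (Ioi 0) := by
  intro x hx
  have hC0 : 0 ≤ C := by simpa using (norm_nonneg _).trans (hC 1 one_pos)
  have : Measurable fun t : ℝ => (t : 𝕜) := RCLike.measurable_ofReal
  refine (continuousAt_of_dominated (bound := fun t => C / (x / 2) * ‖h t‖)
    (Eventually.of_forall fun y => (by fun_prop : Measurable _).aestronglyMeasurable) ?_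
    (hh.norm.const_mul _) ?_).continuousWithinAt
  · filter_upwards [lt_mem_nhds (half_lt_self (mem_Ioi.1 hx))] with y hy
    refine ae_restrict_of_forall_mem measurableSet_Ioi fun t ht => ?_
    have hy0 : 0 < y := (half_pos hx).trans hy
    refine (norm_comp_div_mul_div_le hC h hy0 ht).trans ?_
    have : 0 < x / 2 := half_pos hx
    gcongr
  · refine ae_restrict_of_forall_mem measurableSet_Ioi fun t ht => ?_
    have hft : ContinuousAt (fun y => f (y / t)) x :=
      (hf.continuousAt (Ioi_mem_nhds (div_pos hx ht))).comp
        (f := fun y : ℝ => y / t) (continuousAt_id.div_const t)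
    exact (hft.mul_const _).div_const _

end MulConv

theorem mulConv_pos {f h : ℝ → ℝ} {C x : ℝ} (mf : Measurable f) (hC : ∀ x > 0, ‖f x‖ ≤ C / x)
    (hf : ∀ x > 0, 0 < f x) (mh : Measurable h) (hh : IntegrableOn h (Ioi 0))
    (hpos : ∀ x > 0, 0 < h x) (hx : 0 < x) : 0 < mulConv f h x := by
  have hkernel : ∀ t ∈ Ioi (0 : ℝ), 0 < f (x / t) * h t / t := fun t ht =>
    div_pos (mul_pos (hf _ (div_pos hx ht)) (hpos t ht)) ht
  refine (setIntegral_pos_iff_support_of_nonneg_ae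
    (ae_restrict_of_forall_mem measurableSet_Ioi fun t ht => (hkernel t ht).le)
    (integrableOn_comp_div_mul_div mf hC mh hh hx)).2 ?_
  refine lt_of_lt_of_le (by simp : 0 < volume (Ioi (0 : ℝ))) (measure_mono fun t ht => ?_)
  exact ⟨(hkernel t ht).ne', ht⟩

theorem hasMellin_congr {E : Type*} [NormedAddCommGroup E] [NormedSpace ℂ E] {f g : ℝ → E} {s : ℂ}
    {M : E} (hfg : EqOn f g (Ioi 0)) (hg : HasMellin g s M) : HasMellin f s M := by
  have hsmul : EqOn (fun t : ℝ => (t : ℂ) ^ (s - 1) • f t) (fun t : ℝ => (t : ℂ) ^ (s - 1) • g t)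
      (Ioi 0) := fun t ht => congrArg _ (hfg ht)
  refine ⟨(integrableOn_congr_fun hsmul measurableSet_Ioi).2 hg.1, ?_⟩
  rw [← hg.2, mellin, mellin, setIntegral_congr_fun measurableSet_Ioi hsmul]

theorem hasMellin_mulConv {f h : ℝ → ℂ} (mf : Measurable f) (mh : Measurable h) {s F H : ℂ}
    (hf : HasMellin f s F) (hh : HasMellin h s H) : HasMellin (mulConv f h) s (F * H) := by
  set f' : ℝ → ℂ := fun y => (y : ℂ) ^ (s - 1) • f y
  set h' : ℝ → ℂ := fun t => (t : ℂ) ^ (s - 1) • h t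
  have mf' : Measurable f' := by fun_prop
  have mh' : Measurable h' := by fun_prop
  have hconv : EqOn (fun x : ℝ => (x : ℂ) ^ (s - 1) • mulConv f h x) (mulConv f' h') (Ioi 0) := by
    intro x hx
    simp only [mulConv, ← integral_smul]
    refine setIntegral_congr_fun measurableSet_Ioi fun t ht => ?_
    have hx_eq : (x : ℂ) ^ (s - 1) = ((x / t : ℝ) : ℂ) ^ (s - 1) * (t : ℂ) ^ (s - 1) := by
      rw [← Complex.mul_cpow_ofReal_nonneg (div_pos hx ht).le (le_of_lt ht), ← Complex.ofReal_mul,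
        div_mul_cancel₀ x (ne_of_gt ht)]
    simp only [f', h', smul_eq_mul, hx_eq]
    ring
  refine ⟨(integrableOn_congr_fun hconv measurableSet_Ioi).2
    (integrableOn_mulConv mf' mh' hf.1 hh.1), ?_⟩
  rw [mellin, setIntegral_congr_fun measurableSet_Ioi hconv, integral_mulConv mf' mh' hf.1 hh.1,
    ← hf.2, ← hh.2, mellin, mellin]

theorem hasMellin_one_Ioi {s : ℂ} (hs : s.re < 0) :
    HasMellin (indicator (Ioi 1) (fun _ => 1 : ℝ → ℂ)) s (-1 / s) := by
  have hs1 : (s - 1).re < -1 := by simpa [Complex.sub_re] using sub_lt_sub_right hs 1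
  have hsub : Ioi (1 : ℝ) ⊆ Ioi 0 := Ioi_subset_Ioi zero_le_one
  simp_rw [HasMellin, mellin, MellinConvergent, ← indicator_smul, smul_eq_mul, mul_one,
    IntegrableOn, integrable_indicator_iff measurableSet_Ioi, integral_indicator measurableSet_Ioi,
    IntegrableOn, Measure.restrict_restrict_of_subset hsub]
  refine ⟨integrableOn_Ioi_cpow_of_lt hs1 one_pos, ?_⟩
  simp [integral_Ioi_cpow_of_lt hs1 one_pos]

section Primitive

variable {f : ℝ → ℂ} {s M : ℂ}

theorem hasMellin_ofReal_mul (hf : HasMellin f (s + 1) M) :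
    HasMellin (fun t : ℝ => (t : ℂ) * f t) s M := by
  have hcpow : (fun t : ℝ => (t : ℂ) * f t) = fun t : ℝ => (t : ℂ) ^ (1 : ℂ) • f t := by simp
  rw [hcpow, HasMellin, MellinConvergent.cpow_smul, mellin_cpow_smul]
  exact hf

theorem hasMellin_integral_Ioo (mf : Measurable f) (hs : s.re < 0) (hf : HasMellin f (s + 1) M) :
    HasMellin (fun x => ∫ t in Ioo 0 x, f t) s (-M / s) := by
  have hconv := hasMellin_mulConv (by fun_prop (disch := exact measurableSet_Ioi)) (by fun_prop)
    (hasMellin_one_Ioi hs) (hasMellin_ofReal_mul hf)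
  rw [show -M / s = -1 / s * M by ring]
  refine hasMellin_congr (fun x _ => ?_) hconv
  rw [mulConv, show Ioo 0 x = Ioi 0 ∩ Iio x from rfl, ← setIntegral_indicator measurableSet_Iio]
  refine setIntegral_congr_fun measurableSet_Ioi fun t ht => ?_
  have ht' : (t : ℂ) ≠ 0 := Complex.ofReal_ne_zero.2 (ne_of_gt ht)
  by_cases htx : t < x <;> simp [indicator, one_lt_div ht.out, htx, ht']

theorem hasMellin_integral_Ici (mf : Measurable f) (hs : 0 < s.re) (hf : HasMellin f (s + 1) M) :
    HasMellin (fun x => ∫ t in Ici x, f t) s (M / s) := by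
  have hconv := hasMellin_mulConv (by fun_prop (disch := exact measurableSet_Ioc)) (by fun_prop)
    (hasMellin_one_Ioc hs) (hasMellin_ofReal_mul hf)
  rw [show M / s = 1 / s * M by ring]
  refine hasMellin_congr (fun x hx => ?_) hconv
  rw [mulConv, ← inter_eq_right.2 (Ici_subset_Ioi.2 hx), ← setIntegral_indicator measurableSet_Ici]
  refine setIntegral_congr_fun measurableSet_Ioi fun t ht => ?_
  have ht' : (t : ℂ) ≠ 0 := Complex.ofReal_ne_zero.2 (ne_of_gt ht)
  by_cases htx : x ≤ t <;> simp [indicator, div_le_one ht.out, div_pos hx.out ht.out, htx, ht']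

end Primitive

/-! ### The Gamma function on vertical lines -/

theorem norm_Gamma_le_Gamma_re {s : ℂ} (hs : 0 < s.re) :
    ‖Complex.Gamma s‖ ≤ Real.Gamma s.re := by
  rw [Complex.Gamma_eq_integral hs, Complex.GammaIntegral, Real.Gamma_eq_integral hs]
  refine (norm_integral_le_integral_norm _).trans_eq ?_
  refine setIntegral_congr_fun measurableSet_Ioi fun x hx => ?_
  simp only [norm_mul, Complex.norm_real, Real.norm_eq_abs, Real.abs_exp,
    Complex.norm_cpow_eq_rpow_re_of_pos hx, Complex.sub_re, Complex.one_re]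

section Vertical

variable {c : ℝ}

theorem norm_Gamma_vertical_le (hc : 0 < c) (t : ℝ) :
    ‖Complex.Gamma (c + t * Complex.I)‖ ≤ Real.Gamma c := by
  simpa using norm_Gamma_le_Gamma_re (s := c + t * Complex.I) (by simpa using hc)

/-- The functional equation `Γ (s + 2) = (s + 1) s Γ s` trades the trivial bound at `s + 2` for
quadratic decay at `s`. -/
theorem one_add_sq_mul_norm_Gamma_le (hc : 0 < c) (t : ℝ) :
    (1 + t ^ 2) * ‖Complex.Gamma (c + t * Complex.I)‖ ≤ Real.Gamma c + Real.Gamma (c + 2) := by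
  set s : ℂ := c + t * Complex.I with hs
  have hre : s.re = c := by simp [hs]
  have him : s.im = t := by simp [hs]
  have hs0 : s ≠ 0 := fun h => hc.ne' (by simpa [h] using hre.symm)
  have hs1 : s + 1 ≠ 0 := fun h => by
    have := congrArg Complex.re h
    rw [Complex.add_re, hre, Complex.one_re, Complex.zero_re] at this
    linarith
  have hGamma : Complex.Gamma (s + 2) = (s + 1) * (s * Complex.Gamma s) := by
    rw [show s + 2 = (s + 1) + 1 by ring, Complex.Gamma_add_one _ hs1, Complex.Gamma_add_one _ hs0]
  have hsq : t ^ 2 ≤ ‖s + 1‖ * ‖s‖ := by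
    rw [← sq_abs, sq]
    gcongr
    · simpa [him] using Complex.abs_im_le_norm (s + 1)
    · exact him ▸ Complex.abs_im_le_norm s
  calc (1 + t ^ 2) * ‖Complex.Gamma s‖
      ≤ (1 + ‖s + 1‖ * ‖s‖) * ‖Complex.Gamma s‖ := by gcongr
    _ = ‖Complex.Gamma s‖ + ‖Complex.Gamma (s + 2)‖ := by rw [hGamma, norm_mul, norm_mul]; ring
    _ ≤ Real.Gamma c + Real.Gamma (c + 2) := by
        gcongr
        · exact norm_Gamma_vertical_le hc t
        · simpa [hre] using norm_Gamma_le_Gamma_re (s := s + 2) (by simp [hre]; linarith)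

theorem continuous_Gamma_vertical (hc : 0 < c) :
    Continuous fun t : ℝ => Complex.Gamma (c + t * Complex.I) := by
  refine continuous_iff_continuousAt.2 fun t => ContinuousAt.comp (g := Complex.Gamma)
    (Complex.differentiableAt_Gamma _ fun m h => ?_).continuousAt (by fun_prop)
  have hre : c = -(m : ℝ) := by simpa using congrArg Complex.re h
  linarith [m.cast_nonneg (α := ℝ)]

theorem verticalIntegrable_Gamma (hc : 0 < c) : Complex.VerticalIntegrable Complex.Gamma c := by
  refine Integrable.mono' (integrable_inv_one_add_sq.const_mul (Real.Gamma c + Real.Gamma (c + 2)))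
    (continuous_Gamma_vertical hc).aestronglyMeasurable (Eventually.of_forall fun t => ?_)
  rw [← div_eq_mul_inv, le_div_iff₀' (by positivity)]
  exact one_add_sq_mul_norm_Gamma_le hc t

theorem verticalIntegrable_Gamma_pow (hc : 0 < c) (n : ℕ) :
    Complex.VerticalIntegrable (fun s => Complex.Gamma s ^ (n + 1)) c := by
  induction n with
  | zero => simpa using verticalIntegrable_Gamma hc
  | succ n ih =>
    simpa only [Complex.VerticalIntegrable, pow_succ _ (n + 1)] using
      ih.mul_bdd (continuous_Gamma_vertical hc).aestronglyMeasurable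
        (Eventually.of_forall (norm_Gamma_vertical_le hc))

variable {f : ℂ → ℂ}

theorem verticalIntegrable_comp_const_sub (k : ℝ) (hf : Complex.VerticalIntegrable f (k - c)) :
    Complex.VerticalIntegrable (fun s => f (k - s)) c := by
  refine (Integrable.comp_neg hf).congr (Eventually.of_forall fun t => congrArg f ?_)
  push_cast
  ring

theorem verticalIntegrable_div_self (hc : c ≠ 0) (hf : Complex.VerticalIntegrable f c) :
    Complex.VerticalIntegrable (fun s => f s / s) c := by
  have hne : ∀ t : ℝ, (c + t * Complex.I : ℂ) ≠ 0 := fun t h =>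
    hc (by simpa using congrArg Complex.re h)
  have hcont : Continuous fun t : ℝ => (c + t * Complex.I : ℂ)⁻¹ :=
    Continuous.inv₀ (by fun_prop) hne
  refine hf.mul_bdd (c := |c|⁻¹) hcont.aestronglyMeasurable (Eventually.of_forall fun t => ?_)
  rw [norm_inv]
  have hle : |c| ≤ ‖(c + t * Complex.I : ℂ)‖ := by
    simpa using Complex.abs_re_le_norm (c + t * Complex.I)
  exact inv_anti₀ (abs_pos.2 hc) hle

end Vertical

/-! ### Products of independent exponential variables -/

/-- The density of the product of `n + 1` independent standard exponential variables. -/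
noncomputable def expProductDensity : ℕ → ℝ → ℝ
  | 0 => fun x => Real.exp (-x)
  | n + 1 => mulConv (expProductDensity n) fun t => Real.exp (-t)

theorem integrableOn_exp_neg : IntegrableOn (fun t : ℝ => Real.exp (-t)) (Ioi 0) := by
  simpa using integrableOn_exp_neg_Ioi 0

@[fun_prop]
theorem measurable_expProductDensity (n : ℕ) : Measurable (expProductDensity n) := by
  induction n with
  | zero => exact Real.measurable_exp.comp measurable_neg
  | succ n ih => exact measurable_mulConv ih (by fun_prop)

theorem norm_expProductDensity_le (n : ℕ) {x : ℝ} (hx : 0 < x) :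
    ‖expProductDensity n x‖ ≤ 1 / x := by
  induction n generalizing x with
  | zero =>
    rw [expProductDensity, Real.norm_eq_abs, Real.abs_exp, Real.exp_neg, ← one_div]
    exact one_div_le_one_div_of_le hx (by linarith [Real.add_one_le_exp x])
  | succ n ih =>
    have hle := norm_mulConv_le (fun y hy => ih hy) integrableOn_exp_neg hx
    simpa only [Real.norm_eq_abs, Real.abs_exp, integral_exp_neg_Ioi_zero, mul_one] using! hle

theorem expProductDensity_pos (n : ℕ) {x : ℝ} (hx : 0 < x) : 0 < expProductDensity n x := by
  induction n generalizing x with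
  | zero => exact Real.exp_pos _
  | succ n ih =>
    exact mulConv_pos (measurable_expProductDensity n) (fun y hy => norm_expProductDensity_le n hy)
      (fun y hy => ih hy) (by fun_prop) integrableOn_exp_neg (fun _ _ => Real.exp_pos _) hx

theorem continuousOn_expProductDensity (n : ℕ) : ContinuousOn (expProductDensity n) (Ioi 0) := by
  induction n with
  | zero => exact (Real.continuous_exp.comp continuous_neg).continuousOn
  | succ n ih =>
    exact continuousOn_mulConv (measurable_expProductDensity n)
      (fun y hy => norm_expProductDensity_le n hy) ih (by fun_prop) integrableOn_exp_neg

theorem hasMellin_exp_neg {s : ℂ} (hs : 0 < s.re) :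
    HasMellin (fun x => ((Real.exp (-x) : ℝ) : ℂ)) s (Complex.Gamma s) := by
  refine ⟨(Complex.GammaIntegral_convergent hs).congr (Eventually.of_forall fun x => ?_), ?_⟩
  · simp only [smul_eq_mul, mul_comm]
  · rw [Complex.Gamma_eq_integral hs, Complex.GammaIntegral_eq_mellin]

theorem hasMellin_expProductDensity (n : ℕ) {s : ℂ} (hs : 0 < s.re) :
    HasMellin (fun x => (expProductDensity n x : ℂ)) s (Complex.Gamma s ^ (n + 1)) := by
  induction n with
  | zero => simpa only [expProductDensity, zero_add, pow_one] using hasMellin_exp_neg hs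
  | succ n ih =>
    have hconv := hasMellin_mulConv (by fun_prop) (by fun_prop) ih (hasMellin_exp_neg hs)
    rw [pow_succ]
    exact hasMellin_congr (fun x _ => (mulConv_ofReal _ _ x).symm) hconv

/-! ### Products of independent Gamma variables -/

/-- The density of the product of `n + 1` independent Gamma variables with shape parameter `l + 1`
and scale `1`. -/
noncomputable def gammaProductDensity (n l : ℕ) (t : ℝ) : ℝ :=
  t ^ l * expProductDensity n t / (l.factorial : ℝ) ^ (n + 1)

/-- The probability that the product of `n + 1` independent Gamma variables with shape parameter
`l + 1` and scale `1` is less than `x`. -/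
noncomputable def gammaProductCDF (n l : ℕ) (x : ℝ) : ℝ :=
  ∫ t in Ioo 0 x, gammaProductDensity n l t

@[fun_prop]
theorem measurable_gammaProductDensity (n l : ℕ) : Measurable (gammaProductDensity n l) := by
  unfold gammaProductDensity
  fun_prop

theorem gammaProductDensity_nonneg (n l : ℕ) {t : ℝ} (ht : 0 < t) :
    0 ≤ gammaProductDensity n l t := by
  have := expProductDensity_pos n ht
  unfold gammaProductDensity
  positivity

theorem hasMellin_gammaProductDensity (n l : ℕ) {s : ℂ} (hs : -(l : ℝ) < s.re) :
    HasMellin (fun t => (gammaProductDensity n l t : ℂ)) s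
      (Complex.Gamma (l + s) ^ (n + 1) / (l.factorial : ℂ) ^ (n + 1)) := by
  have hexp : HasMellin _ (s + l) _ :=
    hasMellin_expProductDensity n (by simpa using neg_lt_iff_pos_add.1 hs)
  have hpow : (fun t => (gammaProductDensity n l t : ℂ)) = fun t : ℝ =>
      ((t : ℂ) ^ (l : ℂ) • (expProductDensity n t : ℂ)) / (l.factorial : ℂ) ^ (n + 1) := by
    ext t
    simp [gammaProductDensity]
  rw [hpow, add_comm (l : ℂ)]
  refine ⟨(MellinConvergent.cpow_smul.2 hexp.1).div_const _, ?_⟩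
  rw [mellin_div_const, mellin_cpow_smul, hexp.2]

theorem hasMellin_gammaProductDensity_one (n l : ℕ) :
    HasMellin (fun t => (gammaProductDensity n l t : ℂ)) 1 1 := by
  have h := hasMellin_gammaProductDensity n l (s := 1)
    (by simpa using (neg_nonpos.2 l.cast_nonneg).trans_lt one_pos)
  rwa [Complex.Gamma_nat_eq_factorial,
    div_self (pow_ne_zero _ (Nat.cast_ne_zero.2 l.factorial_ne_zero))] at h

theorem integrableOn_gammaProductDensity (n l : ℕ) :
    IntegrableOn (gammaProductDensity n l) (Ioi 0) := by
  have h := (hasMellin_gammaProductDensity_one n l).1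
  simp only [MellinConvergent, sub_self, Complex.cpow_zero, one_smul] at h
  exact h.re

theorem integral_gammaProductDensity (n l : ℕ) :
    ∫ t in Ioi (0 : ℝ), gammaProductDensity n l t = 1 := by
  have h := (hasMellin_gammaProductDensity_one n l).2
  simp only [mellin, sub_self, Complex.cpow_zero, one_smul, integral_complex_ofReal] at h
  exact_mod_cast h

section CDF

variable (n l : ℕ) {x : ℝ}

theorem one_sub_gammaProductCDF (hx : 0 < x) :
    1 - gammaProductCDF n l x = ∫ t in Ici x, gammaProductDensity n l t := by
  have hint := integrableOn_gammaProductDensity n l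
  have hdisj : Disjoint (Ioo 0 x) (Ici x) :=
    disjoint_left.2 fun t ht hxt => ht.2.not_ge hxt
  rw [sub_eq_iff_eq_add', gammaProductCDF, ← setIntegral_union hdisj measurableSet_Ici
    (hint.mono_set Ioo_subset_Ioi_self) (hint.mono_set (Ici_subset_Ioi.2 hx)),
    Ioo_union_Ici_eq_Ioi hx, integral_gammaProductDensity]

theorem gammaProductCDF_nonneg (x : ℝ) : 0 ≤ gammaProductCDF n l x :=
  setIntegral_nonneg measurableSet_Ioo fun _ ht => gammaProductDensity_nonneg n l ht.1

theorem gammaProductCDF_le_one (hx : 0 < x) : gammaProductCDF n l x ≤ 1 := by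
  rw [← sub_nonneg, one_sub_gammaProductCDF n l hx]
  exact setIntegral_nonneg measurableSet_Ici fun t ht =>
    gammaProductDensity_nonneg n l (hx.trans_le ht)

theorem continuousAt_gammaProductCDF (hx : 0 < x) : ContinuousAt (gammaProductCDF n l) x := by
  have hint := (integrable_indicator_iff measurableSet_Ioi).2 (integrableOn_gammaProductDensity n l)
  have hprim : Continuous fun y => ∫ t in 0..y, indicator (Ioi 0) (gammaProductDensity n l) t :=
    intervalIntegral.continuous_primitive (fun _ _ => hint.intervalIntegrable) 0
  refine hprim.continuousAt.congr ?_
  filter_upwards [lt_mem_nhds hx] with y hy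
  rw [intervalIntegral.integral_of_le hy.le, gammaProductCDF, integral_Ioc_eq_integral_Ioo]
  exact setIntegral_congr_fun measurableSet_Ioo fun t ht => indicator_of_mem ht.1 _

theorem gammaProductCDF_le_pow_div_factorial (hx : 0 < x) :
    gammaProductCDF n l x ≤ x ^ l / l.factorial := by
  have hexp : ∀ t, gammaProductDensity n 0 t = expProductDensity n t := by
    simp [gammaProductDensity]
  have hfact : (l.factorial : ℝ) ≤ (l.factorial : ℝ) ^ (n + 1) :=
    le_self_pow₀ (by exact_mod_cast l.factorial_pos) n.succ_ne_zero
  have : (0 : ℝ) < l.factorial := by exact_mod_cast l.factorial_pos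
  have hle : ∀ t ∈ Ioo 0 x,
      gammaProductDensity n l t ≤ x ^ l / l.factorial * gammaProductDensity n 0 t := by
    rintro t ⟨ht, htx⟩
    have := expProductDensity_pos n ht
    rw [hexp, gammaProductDensity, mul_div_right_comm]
    gcongr
  have hint : ∀ k, IntegrableOn (gammaProductDensity n k) (Ioo 0 x) := fun k =>
    (integrableOn_gammaProductDensity n k).mono_set Ioo_subset_Ioi_self
  calc gammaProductCDF n l x ≤ ∫ t in Ioo 0 x, x ^ l / l.factorial * gammaProductDensity n 0 t :=
        setIntegral_mono_on (hint l) ((hint 0).const_mul _) measurableSet_Ioo hle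
    _ = x ^ l / l.factorial * gammaProductCDF n 0 x := by rw [integral_const_mul, gammaProductCDF]
    _ ≤ x ^ l / l.factorial :=
        mul_le_of_le_one_right (by positivity) (gammaProductCDF_le_one n 0 hx)

theorem summable_gammaProductCDF (hx : 0 < x) : Summable fun l => gammaProductCDF n l x :=
  (Real.summable_pow_div_factorial x).of_nonneg_of_le (fun l => gammaProductCDF_nonneg n l x)
    fun l => gammaProductCDF_le_pow_div_factorial n l hx

variable {s : ℂ}

theorem hasMellin_gammaProductCDF (hs : -(l + 1 : ℝ) < s.re) (hs0 : s.re < 0) :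
    HasMellin (fun x => (gammaProductCDF n l x : ℂ)) s
      (-(Complex.Gamma (l + 1 + s) ^ (n + 1) / (l.factorial : ℂ) ^ (n + 1)) / s) := by
  have hdens : HasMellin _ (s + 1) _ := hasMellin_gammaProductDensity n l
    (by rw [Complex.add_re, Complex.one_re]; linarith)
  rw [show (l + 1 + s : ℂ) = l + (s + 1) by ring]
  simpa only [gammaProductCDF, integral_complex_ofReal] using
    hasMellin_integral_Ioo (by fun_prop) hs0 hdens

theorem hasMellin_one_sub_gammaProductCDF (hs : 0 < s.re) :
    HasMellin (fun x => ((1 - gammaProductCDF n l x : ℝ) : ℂ)) s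
      (Complex.Gamma (l + 1 + s) ^ (n + 1) / (l.factorial : ℂ) ^ (n + 1) / s) := by
  have hdens : HasMellin _ (s + 1) _ := hasMellin_gammaProductDensity n l
    (by rw [Complex.add_re, Complex.one_re]; linarith [l.cast_nonneg (α := ℝ)])
  rw [show (l + 1 + s : ℂ) = l + (s + 1) by ring]
  refine hasMellin_congr (fun x hx => ?_) (hasMellin_integral_Ici (by fun_prop) hs hdens)
  rw [one_sub_gammaProductCDF n l hx, integral_complex_ofReal]

end CDF

/-! ### Evaluation of Meijer G-functions -/

theorem meijerG_eq_of_hasMellin {m n p q : ℕ} {a : Fin p → ℂ} {b : Fin q → ℂ} {x : ℝ} (hx : 0 < x)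
    {F : ℝ → ℂ} {M : ℂ → ℂ} (hF : ContinuousAt F x) (hex : ∃ c : ℝ, Separates m n a b c)
    (hM : ∀ c, Separates m n a b c → Complex.VerticalIntegrable M c)
    (hFM : ∀ s : ℂ, Separates m n a b s.re → HasMellin F (-s) (M s))
    (hint : ∀ s : ℂ, Separates m n a b s.re → meijerIntegrand m n a b x s = (x : ℂ) ^ s * M s) :
    meijerG m n a b x = F x := by
  rw [meijerG, dif_pos hex]
  have hc := hex.choose_spec
  set c := hex.choose
  have hline : ∀ t : ℝ, Separates m n a b (c + t * Complex.I : ℂ).re := fun t => by simpa using hc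
  have hneg : ∀ t : ℝ, (((-c : ℝ) : ℂ) + t * Complex.I) = -(c + ((-t : ℝ) : ℂ) * Complex.I) :=
    fun t => by push_cast; ring
  have hmellin : ∀ t : ℝ, mellin F (((-c : ℝ) : ℂ) + t * Complex.I) =
      M (c + ((-t : ℝ) : ℂ) * Complex.I) := fun t => by rw [hneg, (hFM _ (hline _)).2]
  have hconv : MellinConvergent F ((-c : ℝ) : ℂ) := by simpa using (hFM _ (hline 0)).1
  have hvert : Complex.VerticalIntegrable (mellin F) (-c) :=
    (hM c hc).comp_neg.congr (Eventually.of_forall fun t => (hmellin t).symm)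
  rw [← mellinInv_mellin_eq _ F hx hconv hvert hF, mellinInv, Complex.real_smul,
    ← integral_neg_eq_self]
  congr 1
  · push_cast
    rw [one_div]
  · refine integral_congr_ae (Eventually.of_forall fun t => ?_)
    beta_reduce
    rw [hint _ (hline _), hmellin, hneg, neg_neg, smul_eq_mul]

section Meijer

variable (n k l : ℕ) {x c : ℝ} {s : ℂ}

theorem meijerG_zero_eq_expProductDensity (hx : 0 < x) :
    meijerG (n + 1) 0 (fun i : Fin 0 => i.elim0) (fun _ : Fin (n + 1) => (0 : ℂ)) (x : ℂ) =
      expProductDensity n x := by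
  refine meijerG_eq_of_hasMellin hx (F := fun y => (expProductDensity n y : ℂ))
    (M := fun s => Complex.Gamma (-s) ^ (n + 1))
    (Complex.continuous_ofReal.continuousAt.comp
      ((continuousOn_expProductDensity n).continuousAt (Ioi_mem_nhds hx)))
    ⟨-1, by simp [Separates]⟩ (fun c hc => ?_) (fun s hs => ?_) (fun s _ => ?_)
  · have hc0 : c < 0 := by simpa using hc.1 0 (by simp)
    simpa using verticalIntegrable_comp_const_sub 0
      (verticalIntegrable_Gamma_pow (c := 0 - c) (by linarith) n)
  · have hs0 : s.re < 0 := by simpa using hs.1 0 (by simp)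
    exact hasMellin_expProductDensity n (by simpa using hs0)
  · simp only [meijerIntegrand, Fin.is_lt, if_true, Finset.prod_const, Finset.card_univ,
      Fintype.card_fin, Finset.univ_eq_empty, Finset.prod_empty, mul_one, zero_sub]

theorem separates_snoc_iff : Separates (n + 1) 1 (fun _ : Fin 1 => (1 : ℂ))
    (Fin.snoc (α := fun _ => ℂ) (fun _ : Fin (n + 1) => (k : ℂ)) 0) c ↔ c < k ∧ 0 < c := by
  simp [Separates, Fin.forall_fin_succ', Fin.snoc_castSucc, -Order.lt_add_one_iff]

theorem separates_cons_iff : Separates (n + 2) 0 (fun _ : Fin 1 => (1 : ℂ))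
    (Fin.cons (α := fun _ => ℂ) 0 (fun _ : Fin (n + 1) => (k : ℂ))) c ↔ c < 0 := by
  refine ⟨fun h => by simpa using h.1 0 (by simp), fun h => ⟨Fin.cases ?_ fun i => ?_, by simp⟩⟩
  · simpa using h
  · simpa using fun _ => h.trans_le k.cast_nonneg

theorem meijerIntegrand_snoc (hs : 0 < s.re) :
    meijerIntegrand (n + 1) 1 (fun _ : Fin 1 => (1 : ℂ))
      (Fin.snoc (α := fun _ => ℂ) (fun _ : Fin (n + 1) => (k : ℂ)) 0) x s =
      (x : ℂ) ^ s * (Complex.Gamma (k - s) ^ (n + 1) / s) := by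
  have hs0 : s ≠ 0 := fun h => hs.ne' (by simp [h])
  have hGamma : Complex.Gamma s ≠ 0 := Complex.Gamma_ne_zero_of_re_pos hs
  have hGamma_one : Complex.Gamma (1 + s) = s * Complex.Gamma s := by
    rw [add_comm, Complex.Gamma_add_one s hs0]
  rw [meijerIntegrand, Fin.prod_univ_castSucc]
  simp only [Fin.snoc_castSucc, Fin.val_castSucc, Fin.is_lt, if_true, Fin.snoc_last, Fin.val_last,
    lt_irrefl, if_false, Finset.prod_const, Finset.card_univ, Fintype.card_fin, sub_zero, sub_self,
    zero_add, pow_one, hGamma_one]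
  field_simp

theorem meijerIntegrand_cons (hs : s.re < 0) :
    meijerIntegrand (n + 2) 0 (fun _ : Fin 1 => (1 : ℂ))
      (Fin.cons (α := fun _ => ℂ) 0 (fun _ : Fin (n + 1) => (k : ℂ))) x s =
      (x : ℂ) ^ s * (-(Complex.Gamma (k - s) ^ (n + 1) / s)) := by
  have hs0 : s ≠ 0 := fun h => hs.ne (by simp [h])
  have hGamma : Complex.Gamma (-s) ≠ 0 := Complex.Gamma_ne_zero_of_re_pos (by simpa using hs)
  have hGamma_one : Complex.Gamma (1 - s) = -s * Complex.Gamma (-s) := by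
    rw [sub_eq_neg_add, Complex.Gamma_add_one _ (neg_ne_zero.2 hs0)]
  rw [meijerIntegrand, Fin.prod_univ_succ]
  simp only [Fin.cons_succ, Fin.val_succ, add_lt_add_iff_right, Fin.is_lt, if_true, Fin.cons_zero,
    lt_irrefl, if_false, Finset.prod_const, Finset.card_univ, Fintype.card_fin, zero_sub,
    Fin.prod_univ_one, Fin.val_zero, Nat.zero_lt_succ, hGamma_one]
  field_simp

theorem verticalIntegrable_Gamma_const_sub_pow_div (hc : c < k) (hc0 : c ≠ 0) :
    Complex.VerticalIntegrable (fun s => Complex.Gamma (k - s) ^ (n + 1) / s) c :=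
  verticalIntegrable_div_self hc0 <| by
    simpa using verticalIntegrable_comp_const_sub (k : ℝ)
      (verticalIntegrable_Gamma_pow (sub_pos.2 hc) n)

theorem meijerLower_eq (hx : 0 < x) :
    meijerLower (n + 1) (l + 1) x = (l.factorial : ℂ) ^ (n + 1) * gammaProductCDF n l x := by
  refine meijerG_eq_of_hasMellin hx
    (F := fun y => (l.factorial : ℂ) ^ (n + 1) • (gammaProductCDF n l y : ℂ))
    (M := fun s => Complex.Gamma ((l + 1 : ℕ) - s) ^ (n + 1) / s)
    (continuousAt_const.fun_smul <|
      Complex.continuous_ofReal.continuousAt.comp (continuousAt_gammaProductCDF n l hx))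
    ⟨1 / 2, ?_⟩ (fun c hc => ?_) (fun s hs => ?_) (fun s hs => ?_)
  · rw [separates_snoc_iff]
    push_cast
    constructor <;> linarith [l.cast_nonneg (α := ℝ)]
  · rw [separates_snoc_iff] at hc
    exact verticalIntegrable_Gamma_const_sub_pow_div n (l + 1) hc.1 hc.2.ne'
  · rw [separates_snoc_iff] at hs
    have hF := hasMellin_gammaProductCDF n l (s := -s) (by simpa using hs.1) (by simpa using hs.2)
    convert hasMellin_const_smul hF.1 ((l.factorial : ℂ) ^ (n + 1)) using 1
    rw [hF.2, smul_eq_mul]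
    push_cast
    field_simp [l.factorial_ne_zero]
    ring_nf
  · rw [separates_snoc_iff] at hs
    exact meijerIntegrand_snoc n (l + 1) hs.2

theorem meijerUpper_eq (hx : 0 < x) :
    meijerUpper (n + 1) (l + 1) x = (l.factorial : ℂ) ^ (n + 1) * (1 - gammaProductCDF n l x) := by
  have heval := meijerG_eq_of_hasMellin hx
    (F := fun y => (l.factorial : ℂ) ^ (n + 1) • ((1 - gammaProductCDF n l y : ℝ) : ℂ))
    (M := fun s => -(Complex.Gamma ((l + 1 : ℕ) - s) ^ (n + 1) / s))
    (continuousAt_const.fun_smul <| Complex.continuous_ofReal.continuousAt.comp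
      (continuousAt_const.fun_sub (continuousAt_gammaProductCDF n l hx)))
    ⟨-1, (separates_cons_iff n (l + 1)).2 neg_one_lt_zero⟩ (fun c hc => ?_) (fun s hs => ?_)
    (fun s hs => meijerIntegrand_cons n (l + 1) ((separates_cons_iff n (l + 1)).1 hs))
  · simpa [meijerUpper] using heval
  · rw [separates_cons_iff] at hc
    exact (verticalIntegrable_Gamma_const_sub_pow_div n (l + 1)
      (hc.trans_le (Nat.cast_nonneg _)) hc.ne).neg
  · rw [separates_cons_iff] at hs
    have hF := hasMellin_one_sub_gammaProductCDF n l (s := -s) (by simpa using hs)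
    convert hasMellin_const_smul hF.1 ((l.factorial : ℂ) ^ (n + 1)) using 1
    rw [hF.2, smul_eq_mul]
    push_cast
    field_simp [l.factorial_ne_zero]
    ring_nf

end Meijer

/-! ### Monomial expansion of the interaction -/

/-- The polynomial `F` in `z` and its conjugate has diagonal exponents `d`: it is a finite linear
combination of monomials `∏ z_j ^ a_j * conj z_j ^ b_j` in which `a = b` forces `a` to be a
rearrangement of `d`. Only these diagonal monomials survive integration against a
rotation-invariant product measure. -/
def HasDiagonalExponents {ι : Type*} [Fintype ι] (F : (ι → ℂ) → ℂ) (d : ι → ℕ) : Prop :=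
  ∃ (κ : Type) (_ : Fintype κ) (c : κ → ℂ) (a b : κ → ι → ℕ),
    (∀ z, F z = ∑ i, c i * ∏ j, (z j ^ a i j * conj (z j) ^ b i j)) ∧
    ∀ i, a i = b i → ∃ τ : Equiv.Perm ι, a i = d ∘ τ

/-- The exponent `(β / 2) j - 1` carried by the `j`-th particle; the index starts at `0`, so that
`j` is replaced by `j + 1`. -/
def SymmetryClass.exponent (σ : SymmetryClass) (j : ℕ) : ℕ := σ.beta / 2 * (j + 1) - 1

theorem SymmetryClass.exponent_add_one (σ : SymmetryClass) (j : ℕ) :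
    σ.exponent j + 1 = σ.beta / 2 * (j + 1) := by
  cases σ <;> simp only [exponent, beta] <;> omega

theorem SymmetryClass.exponent_injective (σ : SymmetryClass) : Function.Injective σ.exponent := by
  intro i j hij
  cases σ <;> simp only [exponent, beta] at hij <;> omega

section Vandermonde

variable {R : Type*} [CommRing R] {N M : ℕ}

theorem prod_prod_Iio_eq_prod_prod_Ioi {A : Type*} [CommMonoid A] (f : Fin N → Fin N → A) :
    ∏ j, ∏ k ∈ Finset.Iio j, f j k = ∏ k, ∏ j ∈ Finset.Ioi k, f j k :=
  Finset.prod_comm' (by simp)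

theorem prod_prod_eq_prod_prod_Ioi_mul_prod_diag {A : Type*} [CommMonoid A]
    (f : Fin N → Fin N → A) :
    ∏ i, ∏ j, f i j = (∏ i, ∏ j ∈ Finset.Ioi i, f i j * f j i) * ∏ i, f i i := by
  simp only [fun i => Fintype.prod_eq_mul_prod_compl i (f i), Finset.prod_mul_distrib (s := .univ),
    Finset.prod_prod_Ioi_mul_eq_prod_prod_off_diag fun i j => f j i, mul_comm]

theorem det_vandermonde_eq_sum (v : Fin N → R) :
    (Matrix.vandermonde v).det = ∑ ρ : Equiv.Perm (Fin N), (ρ.sign : R) * ∏ i, v i ^ (ρ i : ℕ) := by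
  rw [← Matrix.det_transpose, Matrix.det_apply']
  simp only [Matrix.transpose_apply, Matrix.vandermonde_apply]

theorem det_vandermonde_append (z : Fin N → R) (w : Fin M → R) :
    (Matrix.vandermonde (Fin.append z w)).det =
      (Matrix.vandermonde z).det * (∏ i, ∏ j, (w j - z i)) * (Matrix.vandermonde w).det := by
  have prod_Ioi {n : ℕ} (i : Fin n) (f : Fin n → R) :
      ∏ j ∈ Finset.Ioi i, f j = ∏ j, if i < j then f j else 1 := by
    rw [← Finset.prod_filter, Finset.filter_lt_eq_Ioi]
  have castAdd_lt_natAdd (i : Fin N) (j : Fin M) : Fin.castAdd M i < Fin.natAdd N j := by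
    rw [Fin.lt_def, Fin.val_castAdd, Fin.val_natAdd]
    omega
  simp only [Matrix.det_vandermonde, prod_Ioi, Fin.prod_univ_add, Fin.append_left, Fin.append_right,
    Finset.prod_mul_distrib, castAdd_lt_natAdd, (castAdd_lt_natAdd _ _).not_gt, if_true, if_false,
    Finset.prod_const_one]
  simp only [one_mul, Fin.lt_def, Fin.val_castAdd, Fin.val_natAdd, add_lt_add_iff_left, mul_assoc]

end Vandermonde

theorem ofReal_norm_sub_sq (a b : ℂ) : ((‖a - b‖ ^ 2 : ℝ) : ℂ) = (a - b) * (conj a - conj b) := by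
  rw [← map_sub, Complex.mul_conj', Complex.ofReal_pow]

theorem interaction_complex_eq {N : ℕ} (z : Fin N → ℂ) :
    (interaction .complex z : ℂ) =
      (Matrix.vandermonde z).det * conj (Matrix.vandermonde z).det := by
  simp only [interaction, prod_prod_Iio_eq_prod_prod_Ioi, Matrix.det_vandermonde, map_prod, map_sub,
    Complex.ofReal_prod, ofReal_norm_sub_sq, Finset.prod_mul_distrib]

theorem interaction_symplectic_eq {N : ℕ} (z : Fin N → ℂ) :
    (interaction .symplectic z : ℂ) =
      (∏ i : Fin N, ∏ _j ∈ Finset.Ioi i, (-1)) * (∏ _i : Fin N, (-1)) *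
        ((Matrix.vandermonde (Fin.append z fun i => conj (z i))).det *
          ∏ i, (conj (z i) - z i)) := by
  have neg_pair (i j : Fin N) : (conj (z j) - z i) * (conj (z i) - z j) =
      -1 * ((z j - conj (z i)) * (conj (z j) - z i)) := by ring
  have neg_diag (i : Fin N) : (z i - conj (z i)) * (conj (z i) - z i) =
      -1 * ((conj (z i) - z i) * (conj (z i) - z i)) := by ring
  have sign_sq : (∏ i : Fin N, ∏ _j ∈ Finset.Ioi i, (-1 : ℂ)) *
      (∏ i : Fin N, ∏ _j ∈ Finset.Ioi i, (-1 : ℂ)) = 1 := by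
    simp only [← Finset.prod_mul_distrib, neg_mul_neg, mul_one, Finset.prod_const_one]
  rw [det_vandermonde_append, prod_prod_eq_prod_prod_Ioi_mul_prod_diag]
  simp only [interaction, prod_prod_Iio_eq_prod_prod_Ioi, Matrix.det_vandermonde,
    Complex.ofReal_mul, Complex.ofReal_prod, ofReal_norm_sub_sq, Complex.conj_conj, neg_pair]
  simp only [neg_diag, Finset.prod_mul_distrib]
  linear_combination (-(∏ i, ∏ j ∈ Finset.Ioi i, (z j - z i)) *
    (∏ i, ∏ j ∈ Finset.Ioi i, (conj (z j) - conj (z i))) *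
    (∏ i, ∏ j ∈ Finset.Ioi i, (z j - conj (z i))) * (∏ i, ∏ j ∈ Finset.Ioi i, (conj (z j) - z i)) *
    (∏ _i : Fin N, (-1)) * (∏ i, (conj (z i) - z i)) * ∏ i, (conj (z i) - z i)) * sign_sq

theorem prod_sub_eq_sum {ι R : Type*} [Fintype ι] [DecidableEq ι] [CommRing R] (x y : ι → R) :
    ∏ j, (x j - y j) = ∑ s : ι → Bool, (∏ j, if s j then 1 else -1) *
      ∏ j, (x j ^ (if s j then 1 else 0) * y j ^ (if s j then 0 else 1)) := by
  have factor (j : ι) : x j - y j = ∑ t : Bool, (if t then 1 else -1) *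
      (x j ^ (if t then 1 else 0) * y j ^ (if t then 0 else 1)) := by
    simp [sub_eq_add_neg]
  simp only [factor, Finset.prod_univ_sum, Fintype.piFinset_univ, Finset.prod_mul_distrib]

theorem val_apply_even_of_involutive_of_neighbours {n : ℕ} {f : Fin n → Fin n}
    (hf : Function.Involutive f) (hnear : ∀ i, (f i : ℕ) = i + 1 ∨ (f i : ℕ) + 1 = i) (k : ℕ)
    (i : Fin n) (hi : (i : ℕ) = 2 * k) :
    (f i : ℕ) = i + 1 := by
  induction k generalizing i with
  | zero => exact (hnear i).resolve_right (by omega)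
  | succ k ih =>
    refine (hnear i).resolve_right fun hfi => ?_
    have hprev := ih ⟨2 * k, by omega⟩ rfl
    have hsame : f ⟨2 * k, by omega⟩ = f i := Fin.ext (hprev.trans (by simp only; omega))
    have := congrArg Fin.val (hf.injective hsame)
    simp only at this
    omega

/-- The pairs `{e (inl j), e (inr j)}` partition `{0, …, 2 * N - 1}` into neighbours, so they are
the blocks `{2 * k, 2 * k + 1}`. -/
theorem exists_perm_max_eq_of_neighbours {N : ℕ} (e : Fin N ⊕ Fin N ≃ Fin (N + N))
    (h : ∀ j, (e (.inr j) : ℕ) = e (.inl j) + 1 ∨ (e (.inr j) : ℕ) + 1 = e (.inl j)) :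
    ∃ τ : Equiv.Perm (Fin N),
      ∀ j, max (e (.inl j) : ℕ) (e (.inr j)) = 2 * (τ j : ℕ) + 1 := by
  let f : Fin (N + N) → Fin (N + N) := fun i => e (e.symm i).swap
  have hf : Function.Involutive f := fun i => by simp [f]
  have hf_inl (j : Fin N) : f (e (.inl j)) = e (.inr j) := by simp [f]
  have hf_inr (j : Fin N) : f (e (.inr j)) = e (.inl j) := by simp [f]
  have hnear (i : Fin (N + N)) : (f i : ℕ) = i + 1 ∨ (f i : ℕ) + 1 = i := by
    obtain ⟨j | j, rfl⟩ := e.surjective i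
    · rw [hf_inl]; exact h j
    · rw [hf_inr]; have := h j; omega
  have hblock (j : Fin N) : ((e (.inl j) : ℕ) % 2 = 0 ∧ (e (.inr j) : ℕ) = e (.inl j) + 1) ∨
      ((e (.inr j) : ℕ) % 2 = 0 ∧ (e (.inl j) : ℕ) = e (.inr j) + 1) := by
    have hinl := val_apply_even_of_involutive_of_neighbours hf hnear (e (.inl j) / 2) (e (.inl j))
    have hinr := val_apply_even_of_involutive_of_neighbours hf hnear (e (.inr j) / 2) (e (.inr j))
    rw [hf_inl] at hinl
    rw [hf_inr] at hinr
    have := h j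
    omega
  let half : Fin N → Fin N := fun j => ⟨e (.inl j) / 2, by omega⟩
  have hhalf : Function.Injective half := by
    intro i j hij
    have hij : (e (.inl i) : ℕ) / 2 = e (.inl j) / 2 := congrArg Fin.val hij
    have hcross (i j : Fin N) : (e (.inl i) : ℕ) ≠ e (.inr j) := fun hval =>
      Sum.inl_ne_inr (e.injective (Fin.ext hval))
    have hval : (e (.inl i) : ℕ) = e (.inl j) := by
      have := hblock i; have := hblock j; have := hcross i j; omega
    exact Sum.inl_injective (e.injective (Fin.ext hval))
  refine ⟨Equiv.ofBijective half (Finite.injective_iff_bijective.1 hhalf), fun j => ?_⟩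
  have := hblock j
  simp only [Equiv.ofBijective_apply, half]
  omega

theorem hasDiagonalExponents_interaction_complex (N : ℕ) :
    HasDiagonalExponents (fun z : Fin N → ℂ => (interaction .complex z : ℂ))
      fun j => SymmetryClass.complex.exponent j := by
  refine ⟨Equiv.Perm (Fin N) × Equiv.Perm (Fin N), inferInstance,
    fun ρ => ρ.1.sign * ρ.2.sign, fun ρ j => ρ.1 j, fun ρ j => ρ.2 j, fun z => ?_,
    fun ρ _ => ⟨ρ.1, funext fun j => ?_⟩⟩
  · beta_reduce
    rw [interaction_complex_eq, det_vandermonde_eq_sum, map_sum, Finset.sum_mul_sum,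
      Fintype.sum_prod_type]
    refine Finset.sum_congr rfl fun ρ _ => Finset.sum_congr rfl fun ρ' _ => ?_
    simp only [map_mul, map_prod, map_pow, Finset.prod_mul_distrib, map_intCast]
    ring
  · simp [SymmetryClass.exponent, SymmetryClass.beta]

theorem hasDiagonalExponents_interaction_symplectic (N : ℕ) :
    HasDiagonalExponents (fun z : Fin N → ℂ => (interaction .symplectic z : ℂ))
      fun j => SymmetryClass.symplectic.exponent j := by
  refine ⟨Equiv.Perm (Fin (N + N)) × (Fin N → Bool), inferInstance,
    fun p => (∏ i : Fin N, ∏ _j ∈ Finset.Ioi i, (-1)) * (∏ _i : Fin N, (-1)) *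
      (p.1.sign * ∏ j, if p.2 j then 1 else -1),
    fun p j => p.1 (Fin.castAdd N j) + if p.2 j then 0 else 1,
    fun p j => p.1 (Fin.natAdd N j) + if p.2 j then 1 else 0, fun z => ?_, fun ⟨ρ, s⟩ hρs => ?_⟩
  · beta_reduce
    rw [interaction_symplectic_eq, det_vandermonde_eq_sum, prod_sub_eq_sum, Finset.sum_mul_sum,
      Finset.mul_sum, Fintype.sum_prod_type]
    refine Finset.sum_congr rfl fun ρ _ => ?_
    rw [Finset.mul_sum]
    refine Finset.sum_congr rfl fun s _ => ?_
    simp only [Fin.prod_univ_add, Fin.append_left, Fin.append_right, pow_add,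
      Finset.prod_mul_distrib]
    ring
  · have hdiag (j : Fin N) : (ρ (Fin.castAdd N j) : ℕ) + (if s j then 0 else 1) =
        ρ (Fin.natAdd N j) + (if s j then 1 else 0) := congrFun hρs j
    obtain ⟨τ, hτ⟩ := exists_perm_max_eq_of_neighbours (finSumFinEquiv.trans ρ) fun j => by
      have := hdiag j
      simp only [Equiv.trans_apply, finSumFinEquiv_apply_left, finSumFinEquiv_apply_right]
      split_ifs at this <;> omega
    refine ⟨τ, funext fun j => ?_⟩
    have hmax := hτ j
    have := hdiag j
    simp only [Equiv.trans_apply, finSumFinEquiv_apply_left, finSumFinEquiv_apply_right] at hmax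
    simp only [Function.comp_apply, SymmetryClass.exponent, SymmetryClass.beta]
    split_ifs at this ⊢ <;> omega

theorem hasDiagonalExponents_interaction (σ : SymmetryClass) (N : ℕ) :
    HasDiagonalExponents (fun z : Fin N → ℂ => (interaction σ z : ℂ)) fun j => σ.exponent j :=
  match σ with
  | .complex => hasDiagonalExponents_interaction_complex N
  | .symplectic => hasDiagonalExponents_interaction_symplectic N

/-! ### Integration against rotation-invariant weights -/

instance : areaMeasure.IsAddHaarMeasure :=
  Measure.IsAddHaarMeasure.smul _ (by simp [Real.pi_pos]) ENNReal.ofReal_ne_top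

/-- All absolute moments of the rotation-invariant weight `z ↦ φ ‖z‖` are finite. -/
def HasRadialMoments (φ : ℝ → ℝ) : Prop :=
  ∀ l : ℕ, Integrable (fun z : ℂ => ‖z‖ ^ l * φ ‖z‖) areaMeasure

/-- The moment of order `2 * l` of the rotation-invariant weight `z ↦ φ ‖z‖`, that is, the squared
norm of the monomial `z ^ l` in the space weighted by `φ`. -/
noncomputable def radialMoment (φ : ℝ → ℝ) (l : ℕ) : ℝ :=
  ∫ z : ℂ, ‖z‖ ^ (2 * l) * φ ‖z‖ ∂areaMeasure

section RadialMoments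

variable {φ : ℝ → ℝ}

theorem HasRadialMoments.integrable (hφ : HasRadialMoments φ) :
    Integrable (fun z : ℂ => φ ‖z‖) areaMeasure := by
  simpa only [pow_zero, one_mul] using hφ 0

theorem HasRadialMoments.integrable_monomial (hφ : HasRadialMoments φ) (a b : ℕ) :
    Integrable (fun z : ℂ => z ^ a * conj z ^ b * (φ ‖z‖ : ℂ)) areaMeasure := by
  have hmono : Continuous fun z : ℂ => z ^ a * conj z ^ b := by fun_prop
  refine (hφ (a + b)).mono
    (hmono.aestronglyMeasurable.mul hφ.integrable.ofReal.aestronglyMeasurable)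
    (Eventually.of_forall fun z => ?_)
  simp [pow_add]

theorem exists_circle_pow_mul_conj_pow_eq_neg_one {a b : ℕ} (hab : a ≠ b) :
    ∃ u : Circle, (u : ℂ) ^ a * conj (u : ℂ) ^ b = -1 := by
  have hab' : (a : ℝ) - b ≠ 0 := sub_ne_zero.2 (by exact_mod_cast hab)
  refine ⟨Circle.exp (Real.pi / (a - b)), ?_⟩
  have hangle : ((Real.pi / (a - b) * (a - b) : ℝ) : ℂ) = Real.pi := by rw [div_mul_cancel₀ _ hab']
  rw [Circle.coe_exp, ← Complex.exp_conj, ← Complex.exp_nat_mul, ← Complex.exp_nat_mul,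
    ← Complex.exp_add, ← Complex.exp_pi_mul_I]
  congr 1
  simp only [map_mul, Complex.conj_ofReal, Complex.conj_I]
  push_cast at hangle ⊢
  linear_combination Complex.I * hangle

theorem measurePreserving_rotation_areaMeasure (u : Circle) :
    MeasurePreserving (rotation u) areaMeasure areaMeasure :=
  (rotation u).measurePreserving.smul_measure _

theorem integral_monomial_of_ne {a b : ℕ} (hab : a ≠ b) :
    ∫ z : ℂ, z ^ a * conj z ^ b * (φ ‖z‖ : ℂ) ∂areaMeasure = 0 := by
  obtain ⟨u, hu⟩ := exists_circle_pow_mul_conj_pow_eq_neg_one hab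
  have hrot := (measurePreserving_rotation_areaMeasure u).integral_comp
    (rotation u).toHomeomorph.measurableEmbedding fun z => z ^ a * conj z ^ b * (φ ‖z‖ : ℂ)
  have hneg (z : ℂ) : (rotation u z) ^ a * conj (rotation u z) ^ b * (φ ‖rotation u z‖ : ℂ) =
      -(z ^ a * conj z ^ b * (φ ‖z‖ : ℂ)) := by
    rw [LinearIsometryEquiv.norm_map, rotation_apply, map_mul, mul_pow, mul_pow]
    linear_combination (z ^ a * conj z ^ b * (φ ‖z‖ : ℂ)) * hu
  simp only [hneg, integral_neg] at hrot
  exact self_eq_neg.1 hrot.symm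

theorem integral_monomial (a b : ℕ) :
    ∫ z : ℂ, z ^ a * conj z ^ b * (φ ‖z‖ : ℂ) ∂areaMeasure =
      if a = b then (radialMoment φ a : ℂ) else 0 := by
  split_ifs with h
  · rw [radialMoment, ← integral_complex_ofReal, ← h]
    simp only [← mul_pow, Complex.mul_conj', pow_mul, Complex.ofReal_mul, Complex.ofReal_pow]
  · exact integral_monomial_of_ne h

end RadialMoments

section DiagonalExponents

variable {ι : Type*} [Fintype ι] {φ : ℝ → ℝ} {F : (ι → ℂ) → ℂ} {d : ι → ℕ}

theorem integrable_prod_monomial (hφ : HasRadialMoments φ) (a b : ι → ℕ) :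
    Integrable (fun z : ι → ℂ => (∏ j, (z j ^ a j * conj (z j) ^ b j)) * ∏ j, (φ ‖z j‖ : ℂ))
      (Measure.pi fun _ => areaMeasure) := by
  simp only [← Finset.prod_mul_distrib]
  exact Integrable.fintype_prod fun j => hφ.integrable_monomial (a j) (b j)

theorem integral_prod_monomial (a b : ι → ℕ) :
    ∫ z : ι → ℂ, (∏ j, (z j ^ a j * conj (z j) ^ b j)) * ∏ j, (φ ‖z j‖ : ℂ)
        ∂(Measure.pi fun _ => areaMeasure) =
      ∏ j, if a j = b j then (radialMoment φ (a j) : ℂ) else 0 := by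
  simp only [← Finset.prod_mul_distrib]
  rw [integral_fintype_prod_eq_prod (f := fun j z => z ^ a j * conj z ^ b j * (φ ‖z‖ : ℂ))]
  simp only [integral_monomial]

theorem HasDiagonalExponents.integrable_mul_prod (hF : HasDiagonalExponents F d)
    (hφ : HasRadialMoments φ) :
    Integrable (fun z => F z * ∏ j, (φ ‖z j‖ : ℂ)) (Measure.pi fun _ => areaMeasure) := by
  obtain ⟨κ, _, c, a, b, hexpansion, -⟩ := hF
  simp only [hexpansion, Finset.sum_mul, mul_assoc]
  exact integrable_finsetSum _ fun i _ => (integrable_prod_monomial hφ (a i) (b i)).const_mul (c i)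

theorem HasDiagonalExponents.exists_integral_mul_prod (hF : HasDiagonalExponents F d) :
    ∃ C : ℂ, ∀ φ : ℝ → ℝ, HasRadialMoments φ →
      ∫ z, F z * ∏ j, (φ ‖z j‖ : ℂ) ∂(Measure.pi fun _ => areaMeasure) =
        C * ∏ j, (radialMoment φ (d j) : ℂ) := by
  classical
  obtain ⟨κ, _, c, a, b, hexpansion, hdiag⟩ := hF
  refine ⟨∑ i, if a i = b i then c i else 0, fun φ hφ => ?_⟩
  simp only [hexpansion, Finset.sum_mul, mul_assoc]
  rw [integral_finsetSum _ fun i _ => (integrable_prod_monomial hφ (a i) (b i)).const_mul (c i)]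
  refine Finset.sum_congr rfl fun i _ => ?_
  rw [integral_const_mul, integral_prod_monomial]
  split_ifs with h
  · obtain ⟨τ, hτ⟩ := hdiag i h
    simp only [← h, if_true, hτ, Function.comp_apply]
    rw [Equiv.prod_comp τ fun k => (radialMoment φ (d k) : ℂ)]
  · obtain ⟨j, hj⟩ := Function.ne_iff.1 h
    rw [Finset.prod_eq_zero (Finset.mem_univ j) (if_neg hj), mul_zero, zero_mul]

end DiagonalExponents

/-! ### The Poisson binomial law -/

section PoissonBinomial

variable {ι : Type*} [Fintype ι]

/-- The Poisson binomial law: the law of the number of successes in independent trials, the `i`-th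
of which succeeds with probability `p i`. As the number of points in a disc is a real number, this
is a measure on `ℝ`. -/
noncomputable def poissonBinomial (p : ι → unitInterval) : Measure ℝ :=
  (Measure.pi fun i => bernoulliMeasure (1 : ℝ) 0 (p i)).map fun ω => ∑ i, ω i

variable (p : ι → unitInterval)

instance isProbabilityMeasure_poissonBinomial : IsProbabilityMeasure (poissonBinomial p) :=
  Measure.isProbabilityMeasure_map (by fun_prop)

theorem mgf_poissonBinomial (t : ℝ) :
    mgf id (poissonBinomial p) t = ∏ i, (1 + (Real.exp t - 1) * p i) := by
  have hexp (ω : ι → ℝ) : Real.exp (t * ∑ i, ω i) = ∏ i, Real.exp (t * ω i) := by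
    rw [Finset.mul_sum, Real.exp_sum]
  rw [poissonBinomial, mgf_id_map (by fun_prop), mgf]
  simp only [hexp]
  rw [integral_fintype_prod_eq_prod (f := fun _ x => Real.exp (t * x))]
  refine Finset.prod_congr rfl fun i _ => ?_
  rw [integral_bernoulliMeasure]
  simp only [mul_one, mul_zero, Real.exp_zero, smul_eq_mul]
  ring

theorem integral_poissonBinomial : ∫ x, x ∂(poissonBinomial p) = ∑ i, (p i : ℝ) := by
  have heval (i : ι) := measurePreserving_eval (fun i => bernoulliMeasure (1 : ℝ) 0 (p i)) i
  have hint (i : ι) : Integrable (fun ω : ι → ℝ => ω i)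
      (Measure.pi fun i => bernoulliMeasure (1 : ℝ) 0 (p i)) :=
    (heval i).integrable_comp_of_integrable (integrable_bernoulliMeasure _ _ _ fun x => x)
  rw [poissonBinomial, integral_map (by fun_prop) (by fun_prop),
    integral_finsetSum _ fun i _ => hint i]
  refine Finset.sum_congr rfl fun i _ => (heval i).hasLaw.integral_eq.trans ?_
  rw [integral_bernoulliMeasure]
  simp

theorem memLp_two_id_bernoulliMeasure (q : unitInterval) :
    MemLp id 2 (bernoulliMeasure (1 : ℝ) 0 q) :=
  (memLp_two_iff_integrable_sq aestronglyMeasurable_id).2 (integrable_bernoulliMeasure _ _ _ _)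

theorem variance_id_bernoulliMeasure (q : unitInterval) :
    Var[id; bernoulliMeasure (1 : ℝ) 0 q] = q * (1 - q) := by
  rw [variance_eq_sub (memLp_two_id_bernoulliMeasure q), integral_bernoulliMeasure,
    integral_bernoulliMeasure]
  simp only [Pi.pow_apply, id_eq, smul_eq_mul]
  ring

theorem variance_id_poissonBinomial :
    Var[id; poissonBinomial p] = ∑ i, (p i : ℝ) * (1 - p i) := by
  have hsum := variance_sum_pi fun i => memLp_two_id_bernoulliMeasure (p i)
  simp only [variance_id_bernoulliMeasure] at hsum
  rw [poissonBinomial, variance_id_map (by fun_prop), ← hsum]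
  congr 1
  ext ω
  simp

end PoissonBinomial

theorem eq_of_mgf_id_eq {μ ν : Measure ℝ} [IsProbabilityMeasure μ] [IsFiniteMeasure ν]
    (hexp : ∀ t, Integrable (fun x => Real.exp (t * x)) μ) (hmgf : mgf id μ = mgf id ν) :
    μ = ν := by
  have huniv : integrableExpSet id μ = univ := eq_univ_of_forall hexp
  refine Measure.ext_of_complexMGF_id_eq (funext fun z => eqOn_complexMGF_of_mgf hmgf ?_)
  rw [huniv, interior_univ]
  exact mem_univ _

/-! ### Gibbs measures in a rotation-invariant potential -/

section Interaction

variable (σ : SymmetryClass) {N : ℕ} {φ : ℝ → ℝ}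

theorem continuous_interaction (N : ℕ) : Continuous fun z : Fin N → ℂ => interaction σ z := by
  cases σ <;> unfold interaction <;> fun_prop

theorem interaction_nonneg (z : Fin N → ℂ) : 0 ≤ interaction σ z := by
  cases σ <;> unfold interaction <;> positivity

theorem interaction_ne_zero {z : Fin N → ℂ} (hz : Function.Injective z)
    (hconj : ∀ j k, z j ≠ conj (z k)) : interaction σ z ≠ 0 := by
  have hsub {j k : Fin N} (hk : k ∈ Finset.Iio j) : ‖z j - z k‖ ^ 2 ≠ 0 :=
    pow_ne_zero _ (norm_ne_zero_iff.2 (sub_ne_zero.2 (hz.ne (Finset.mem_Iio.1 hk).ne')))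
  have hsub_conj (j k : Fin N) : ‖z j - conj (z k)‖ ^ 2 ≠ 0 :=
    pow_ne_zero _ (norm_ne_zero_iff.2 (sub_ne_zero.2 (hconj j k)))
  cases σ <;> simp only [interaction]
  · exact Finset.prod_ne_zero_iff.2 fun j _ => Finset.prod_ne_zero_iff.2 fun k hk => hsub hk
  · exact mul_ne_zero
      (Finset.prod_ne_zero_iff.2 fun j _ => Finset.prod_ne_zero_iff.2 fun k hk =>
        mul_ne_zero (hsub hk) (hsub_conj j k))
      (Finset.prod_ne_zero_iff.2 fun j _ => hsub_conj j j)

theorem exists_interaction_ne_zero (N : ℕ) : ∃ z : Fin N → ℂ, interaction σ z ≠ 0 := by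
  refine ⟨fun j => ⟨0, j + 1⟩, interaction_ne_zero σ (fun j k hjk => ?_) fun j k hjk => ?_⟩
  · simpa [Fin.ext_iff] using congrArg Complex.im hjk
  · have him : (j : ℝ) + 1 = -(k + 1) := congrArg Complex.im hjk
    have : (0 : ℝ) ≤ j + k := by positivity
    linarith

theorem integrable_interaction_mul (N : ℕ) (hφ : HasRadialMoments φ) :
    Integrable (fun z : Fin N → ℂ => interaction σ z * ∏ j, φ ‖z j‖)
      (Measure.pi fun _ => areaMeasure) := by
  have h := (hasDiagonalExponents_interaction σ N).integrable_mul_prod hφ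
  simp only [← Complex.ofReal_prod, ← Complex.ofReal_mul] at h
  exact h.re

theorem exists_integral_interaction_mul (N : ℕ) :
    ∃ C : ℝ, ∀ φ : ℝ → ℝ, HasRadialMoments φ →
      ∫ z : Fin N → ℂ, interaction σ z * ∏ j, φ ‖z j‖ ∂(Measure.pi fun _ => areaMeasure) =
        C * ∏ j : Fin N, radialMoment φ (σ.exponent j) := by
  obtain ⟨C, hC⟩ := (hasDiagonalExponents_interaction σ N).exists_integral_mul_prod
  refine ⟨C.re, fun φ hφ => ?_⟩
  have h := hC φ hφ
  simp only [← Complex.ofReal_prod, ← Complex.ofReal_mul, integral_complex_ofReal] at h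
  rw [← Complex.re_mul_ofReal, ← h, Complex.ofReal_re]

end Interaction

section Gibbs

/-- The Boltzmann factor `exp (-N Q z)` of the potential `Q` is, up to a null set, the
rotation-invariant weight `φ ‖z‖`, and this weight has finite moments. The null set is there for
potentials with a conventional value at the origin. -/
structure IsRadialBoltzmannFactor (N : ℕ) (Q : ℂ → ℝ) (φ : ℝ → ℝ) : Prop where
  hasRadialMoments : HasRadialMoments φ
  ae_eq : ∀ᵐ z ∂areaMeasure, Real.exp (-((N : ℝ) * Q z)) = φ ‖z‖

variable {σ : SymmetryClass} {N : ℕ} {Q : ℂ → ℝ} {φ : ℝ → ℝ}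

theorem jointWeight_nonneg (σ : SymmetryClass) (N : ℕ) (Q : ℂ → ℝ) (z : Fin N → ℂ) :
    0 ≤ jointWeight σ N Q z :=
  mul_nonneg (interaction_nonneg σ z) (Finset.prod_nonneg fun _ _ => (Real.exp_pos _).le)

theorem IsRadialBoltzmannFactor.jointWeight_ae_eq (h : IsRadialBoltzmannFactor N Q φ) :
    jointWeight σ N Q =ᵐ[Measure.pi fun _ => areaMeasure]
      fun z => interaction σ z * ∏ j, φ ‖z j‖ := by
  have hfactor : ∀ᵐ z : Fin N → ℂ ∂(Measure.pi fun _ => areaMeasure),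
      ∀ j, Real.exp (-((N : ℝ) * Q (z j))) = φ ‖z j‖ :=
    ae_all_iff.2 fun j =>
      (Measure.quasiMeasurePreserving_eval (fun _ => areaMeasure) j).ae h.ae_eq
  filter_upwards [hfactor] with z hz
  simp only [jointWeight, hz]

theorem IsRadialBoltzmannFactor.integrable_jointWeight (h : IsRadialBoltzmannFactor N Q φ) :
    Integrable (jointWeight σ N Q) (Measure.pi fun _ => areaMeasure) :=
  (integrable_interaction_mul σ N h.hasRadialMoments).congr h.jointWeight_ae_eq.symm

theorem IsRadialBoltzmannFactor.partitionFunction_pos (h : IsRadialBoltzmannFactor N Q φ) :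
    0 < partitionFunction σ N Q := by
  have hsupport : Function.support (jointWeight σ N Q) = {z : Fin N → ℂ | interaction σ z ≠ 0} := by
    ext z
    simp [jointWeight, Finset.prod_ne_zero_iff, Real.exp_ne_zero]
  rw [partitionFunction, integral_pos_iff_support_of_nonneg (jointWeight_nonneg σ N Q)
    h.integrable_jointWeight, hsupport]
  exact (isOpen_ne_fun (continuous_interaction σ N) continuous_const).measure_pos _
    (exists_interaction_ne_zero σ N)

theorem IsRadialBoltzmannFactor.isProbabilityMeasure_gibbsMeasure
    (h : IsRadialBoltzmannFactor N Q φ) : IsProbabilityMeasure (gibbsMeasure σ N Q) := by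
  have hZ := h.partitionFunction_pos (σ := σ)
  refine ⟨?_⟩
  rw [gibbsMeasure, withDensity_apply _ MeasurableSet.univ, Measure.restrict_univ,
    ← ofReal_integral_eq_lintegral_ofReal (h.integrable_jointWeight.div_const _)
      (Eventually.of_forall fun z => div_nonneg (jointWeight_nonneg σ N Q z) hZ.le),
    integral_div, ← partitionFunction, div_self hZ.ne', ENNReal.ofReal_one]

theorem IsRadialBoltzmannFactor.integral_gibbsMeasure (h : IsRadialBoltzmannFactor N Q φ)
    (F : (Fin N → ℂ) → ℝ) :
    ∫ z, F z ∂(gibbsMeasure σ N Q) =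
      (∫ z, jointWeight σ N Q z * F z ∂(Measure.pi fun _ => areaMeasure)) /
        partitionFunction σ N Q := by
  have hZ := h.partitionFunction_pos (σ := σ)
  rw [gibbsMeasure, integral_withDensity_eq_integral_toReal_smul₀
    (h.integrable_jointWeight.div_const _).aestronglyMeasurable.aemeasurable.ennreal_ofReal
    (Eventually.of_forall fun z => ENNReal.ofReal_lt_top), ← integral_div]
  refine integral_congr_ae (Eventually.of_forall fun z => ?_)
  simp only [smul_eq_mul,
    ENNReal.toReal_ofReal (div_nonneg (jointWeight_nonneg σ N Q z) hZ.le), div_mul_eq_mul_div]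

theorem IsRadialBoltzmannFactor.integral_prod_gibbsMeasure (h : IsRadialBoltzmannFactor N Q φ)
    {g : ℝ → ℝ} (hg : HasRadialMoments fun r => φ r * g r) :
    ∫ z, ∏ j, g ‖z j‖ ∂(gibbsMeasure σ N Q) =
      ∏ j : Fin N, radialMoment (fun r => φ r * g r) (σ.exponent j) /
        radialMoment φ (σ.exponent j) := by
  obtain ⟨C, hC⟩ := exists_integral_interaction_mul σ N
  have hZ : partitionFunction σ N Q = C * ∏ j : Fin N, radialMoment φ (σ.exponent j) :=
    (integral_congr_ae h.jointWeight_ae_eq).trans (hC φ h.hasRadialMoments)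
  have hnumerator : ∫ z, jointWeight σ N Q z * ∏ j, g ‖z j‖ ∂(Measure.pi fun _ => areaMeasure) =
      C * ∏ j : Fin N, radialMoment (fun r => φ r * g r) (σ.exponent j) := by
    rw [← hC _ hg]
    refine integral_congr_ae ?_
    filter_upwards [h.jointWeight_ae_eq (σ := σ)] with z hz
    rw [hz, mul_assoc, ← Finset.prod_mul_distrib]
  have hC0 : C ≠ 0 := left_ne_zero_of_mul (hZ ▸ h.partitionFunction_pos (σ := σ).ne')
  rw [h.integral_gibbsMeasure, hnumerator, hZ, mul_div_mul_left _ _ hC0, Finset.prod_div_distrib]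

theorem IsRadialBoltzmannFactor.radialMoment_pos (h : IsRadialBoltzmannFactor N Q φ) (l : ℕ) :
    0 < radialMoment φ l := by
  have hae : (fun z : ℂ => ‖z‖ ^ (2 * l) * φ ‖z‖) =ᵐ[areaMeasure]
      fun z => ‖z‖ ^ (2 * l) * Real.exp (-((N : ℝ) * Q z)) := by
    filter_upwards [h.ae_eq] with z hz
    rw [hz]
  rw [radialMoment, integral_congr_ae hae, integral_pos_iff_support_of_nonneg
    (fun z => by positivity) ((h.hasRadialMoments _).congr hae)]
  refine (isOpen_compl_singleton.measure_pos areaMeasure ⟨1, one_ne_zero⟩).trans_le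
    (measure_mono fun z (hz : z ≠ 0) => ?_)
  exact mul_ne_zero (pow_ne_zero _ (norm_ne_zero_iff.2 hz)) (Real.exp_ne_zero _)

theorem exp_mul_pointCount (a t : ℝ) (z : Fin N → ℂ) :
    Real.exp (t * pointCount a z) = ∏ j, if ‖z j‖ < a then Real.exp t else 1 := by
  rw [pointCount, mul_comm, Real.exp_nat_mul, Finset.prod_ite, Finset.prod_const,
    Finset.prod_const_one, mul_one]

theorem measurable_pointCount (a : ℝ) : Measurable fun z : Fin N → ℂ => pointCount a z := by
  simp only [pointCount, Finset.card_filter, Nat.cast_sum, Nat.cast_ite]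
  exact Finset.measurable_fun_sum _ fun j _ =>
    Measurable.ite (measurableSet_lt (by fun_prop) measurable_const) measurable_const
      measurable_const

theorem pointCount_mem_Icc (a : ℝ) (z : Fin N → ℂ) : pointCount a z ∈ Icc (0 : ℝ) N := by
  refine ⟨Nat.cast_nonneg _, Nat.cast_le.2 ?_⟩
  exact (Finset.card_le_univ _).trans_eq (Fintype.card_fin N)

theorem HasRadialMoments.indicator_Iio (hφ : HasRadialMoments φ) (a : ℝ) :
    HasRadialMoments ((Iio a).indicator φ) := fun l => by
  refine ((hφ l).indicator (Metric.isOpen_ball (x := (0 : ℂ)) (ε := a)).measurableSet).congr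
    (Eventually.of_forall fun z => ?_)
  simp only [indicator, mem_ball_zero_iff, mem_Iio, mul_ite, mul_zero]

theorem radialMoment_mul_ite (hφ : HasRadialMoments φ) (a c : ℝ) (l : ℕ) :
    radialMoment (fun r => φ r * if r < a then c else 1) l =
      radialMoment φ l + (c - 1) * radialMoment ((Iio a).indicator φ) l := by
  rw [radialMoment, radialMoment, radialMoment, ← integral_const_mul,
    ← integral_add (hφ _) ((hφ.indicator_Iio a _).const_mul _)]
  refine integral_congr_ae (Eventually.of_forall fun z => ?_)
  simp only [indicator, mem_Iio]
  split_ifs <;> ring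

theorem HasRadialMoments.mul_ite (hφ : HasRadialMoments φ) (a c : ℝ) :
    HasRadialMoments fun r => φ r * if r < a then c else 1 := fun l => by
  refine ((hφ l).add ((hφ.indicator_Iio a l).const_mul (c - 1))).congr
    (Eventually.of_forall fun z => ?_)
  simp only [Pi.add_apply, indicator, mem_Iio]
  split_ifs <;> ring

theorem IsRadialBoltzmannFactor.hasLaw_pointCount (h : IsRadialBoltzmannFactor N Q φ) {a : ℝ}
    {p : Fin N → unitInterval}
    (hp : ∀ j : Fin N, radialMoment ((Iio a).indicator φ) (σ.exponent j) =
      p j * radialMoment φ (σ.exponent j)) :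
    HasLaw (fun z : Fin N → ℂ => pointCount a z) (poissonBinomial p) (gibbsMeasure σ N Q) := by
  have := h.isProbabilityMeasure_gibbsMeasure (σ := σ)
  have hmeas := (measurable_pointCount (N := N) a).aemeasurable (μ := gibbsMeasure σ N Q)
  have := Measure.isProbabilityMeasure_map hmeas
  refine ⟨hmeas, eq_of_mgf_id_eq (fun t => ?_) (funext fun t => ?_)⟩
  · rw [integrable_map_measure (by fun_prop) hmeas]
    exact integrable_exp_mul_of_mem_Icc hmeas (Eventually.of_forall (pointCount_mem_Icc a))
  · rw [mgf_id_map hmeas, mgf_poissonBinomial, mgf]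
    simp only [exp_mul_pointCount]
    rw [h.integral_prod_gibbsMeasure (g := fun r => if r < a then Real.exp t else 1)
      (h.hasRadialMoments.mul_ite a _)]
    refine Finset.prod_congr rfl fun j _ => ?_
    have hne := (h.radialMoment_pos (σ.exponent j)).ne'
    rw [radialMoment_mul_ite h.hasRadialMoments, hp]
    field_simp

theorem IsRadialBoltzmannFactor.meanNumber_eq (h : IsRadialBoltzmannFactor N Q φ) {a : ℝ}
    {p : Fin N → unitInterval}
    (hp : ∀ j : Fin N, radialMoment ((Iio a).indicator φ) (σ.exponent j) =
      p j * radialMoment φ (σ.exponent j)) :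
    meanNumber σ N Q a = ∑ j, (p j : ℝ) :=
  (h.hasLaw_pointCount hp).integral_eq.trans (integral_poissonBinomial p)

theorem IsRadialBoltzmannFactor.numberVariance_eq (h : IsRadialBoltzmannFactor N Q φ) {a : ℝ}
    {p : Fin N → unitInterval}
    (hp : ∀ j : Fin N, radialMoment ((Iio a).indicator φ) (σ.exponent j) =
      p j * radialMoment φ (σ.exponent j)) :
    numberVariance σ N Q a = ∑ j, (p j : ℝ) * (1 - p j) :=
  (h.hasLaw_pointCount hp).variance_eq.trans (variance_id_poissonBinomial p)

end Gibbs

/-! ### The potential of a product of Ginibre matrices -/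

section PolarCoordinates

theorem areaMeasure_real_ball : areaMeasure.real (Metric.ball (0 : ℂ) 1) = 1 := by
  rw [areaMeasure, measureReal_ennreal_smul_apply, Measure.real, Complex.volume_ball]
  simp [Real.pi_pos.le, Real.pi_pos.ne']

theorem two_mul_rpow_smul_comp_rpow (H : ℝ → ℝ) (r : ℝ) :
    (2 * r ^ ((2 : ℝ) - 1)) • H (r ^ (2 : ℝ)) =
      2 * r ^ (Module.finrank ℝ ℂ - 1) • H (r ^ 2) := by
  rw [Complex.finrank_real_complex, Real.rpow_two, show (2 : ℝ) - 1 = 1 by norm_num, Real.rpow_one,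
    pow_one, smul_eq_mul, smul_eq_mul, mul_assoc]

theorem integral_comp_norm_sq (H : ℝ → ℝ) :
    ∫ z : ℂ, H (‖z‖ ^ 2) ∂areaMeasure = ∫ y in Ioi (0 : ℝ), H y := by
  rw [integral_fun_norm_addHaar areaMeasure fun r => H (r ^ 2), areaMeasure_real_ball,
    ← integral_comp_rpow_Ioi_of_pos (g := H) two_pos]
  simp only [two_mul_rpow_smul_comp_rpow, integral_const_mul]
  simp [Complex.finrank_real_complex]

theorem integrable_comp_norm_sq_iff {H : ℝ → ℝ} :
    Integrable (fun z : ℂ => H (‖z‖ ^ 2)) areaMeasure ↔ IntegrableOn H (Ioi 0) := by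
  rw [integrable_fun_norm_addHaar areaMeasure (f := fun r => H (r ^ 2)),
    ← integrableOn_Ioi_comp_rpow_iff H two_ne_zero, abs_of_pos two_pos]
  simp only [two_mul_rpow_smul_comp_rpow, IntegrableOn]
  exact (integrable_const_mul_iff two_ne_zero.isUnit _).symm

variable {κ : ℝ} {G : ℝ → ℝ}

theorem pow_mul_comp_mul_left (hκ : 0 < κ) (l : ℕ) (y : ℝ) :
    y ^ l * G (κ * y) = (κ ^ l)⁻¹ * ((κ * y) ^ l * G (κ * y)) := by
  rw [mul_pow]
  field_simp

theorem radialMoment_comp_mul_sq (hκ : 0 < κ) (G : ℝ → ℝ) (l : ℕ) :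
    radialMoment (fun r => G (κ * r ^ 2)) l =
      (κ ^ (l + 1))⁻¹ * ∫ y in Ioi (0 : ℝ), y ^ l * G y := by
  have h := integral_comp_norm_sq fun y => y ^ l * G (κ * y)
  simp only [← pow_mul] at h
  rw [radialMoment, h]
  simp only [pow_mul_comp_mul_left hκ]
  rw [integral_const_mul, integral_comp_mul_left_Ioi (fun y => y ^ l * G y) 0 hκ, mul_zero,
    smul_eq_mul, ← mul_assoc, ← mul_inv, ← pow_succ]

theorem integrable_norm_pow_two_mul_comp_mul_sq (hκ : 0 < κ) {l : ℕ}
    (hG : IntegrableOn (fun y => y ^ l * G y) (Ioi 0)) :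
    Integrable (fun z : ℂ => ‖z‖ ^ (2 * l) * G (κ * ‖z‖ ^ 2)) areaMeasure := by
  have hcomp := (integrableOn_Ioi_comp_mul_left_iff (fun y => y ^ l * G y) 0 hκ).2
    (by rwa [mul_zero])
  have h : IntegrableOn (fun y => y ^ l * G (κ * y)) (Ioi 0) := by
    simp only [pow_mul_comp_mul_left hκ]
    exact hcomp.const_mul _
  simpa only [← pow_mul] using integrable_comp_norm_sq_iff.2 h

theorem hasRadialMoments_comp_mul_sq (hκ : 0 < κ)
    (hG : ∀ l : ℕ, IntegrableOn (fun y => y ^ l * G y) (Ioi 0)) :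
    HasRadialMoments fun r => G (κ * r ^ 2) := fun l => by
  have heven (l : ℕ) := integrable_norm_pow_two_mul_comp_mul_sq hκ (hG l)
  have hzero : Integrable (fun z : ℂ => G (κ * ‖z‖ ^ 2)) areaMeasure := by
    simpa only [mul_zero, pow_zero, one_mul] using heven 0
  have hpow : Continuous fun z : ℂ => ‖z‖ ^ l := by fun_prop
  refine (hzero.norm.add (heven l).norm).mono'
    (hpow.aestronglyMeasurable.mul hzero.aestronglyMeasurable) (Eventually.of_forall fun z => ?_)
  have hodd : ‖z‖ ^ l ≤ 1 + ‖z‖ ^ (2 * l) := by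
    rw [mul_comm 2 l, pow_mul]
    nlinarith [sq_nonneg (‖z‖ ^ l - 1)]
  calc ‖‖z‖ ^ l * G (κ * ‖z‖ ^ 2)‖ = ‖z‖ ^ l * ‖G (κ * ‖z‖ ^ 2)‖ := by
        rw [norm_mul, norm_pow, norm_norm]
    _ ≤ (1 + ‖z‖ ^ (2 * l)) * ‖G (κ * ‖z‖ ^ 2)‖ := by gcongr
    _ = ‖G (κ * ‖z‖ ^ 2)‖ + ‖‖z‖ ^ (2 * l) * G (κ * ‖z‖ ^ 2)‖ := by
        rw [one_add_mul, norm_mul, norm_pow, norm_norm]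

end PolarCoordinates

section ExpProductDensity

variable (n l : ℕ)

theorem pow_mul_expProductDensity (y : ℝ) :
    y ^ l * expProductDensity n y = (l.factorial : ℝ) ^ (n + 1) * gammaProductDensity n l y := by
  rw [gammaProductDensity, mul_div_cancel₀ _ (by positivity)]

theorem integrableOn_pow_mul_expProductDensity :
    IntegrableOn (fun y => y ^ l * expProductDensity n y) (Ioi 0) := by
  simp only [pow_mul_expProductDensity]
  exact (integrableOn_gammaProductDensity n l).const_mul _

theorem integral_pow_mul_expProductDensity :
    ∫ y in Ioi (0 : ℝ), y ^ l * expProductDensity n y = (l.factorial : ℝ) ^ (n + 1) := by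
  simp only [pow_mul_expProductDensity]
  rw [integral_const_mul, integral_gammaProductDensity, mul_one]

theorem integral_pow_mul_indicator_Iio_expProductDensity (x : ℝ) :
    ∫ y in Ioi (0 : ℝ), y ^ l * (Iio x).indicator (expProductDensity n) y =
      (l.factorial : ℝ) ^ (n + 1) * gammaProductCDF n l x := by
  simp only [← indicator_mul_right (Iio x) fun y : ℝ => y ^ l, pow_mul_expProductDensity]
  rw [setIntegral_indicator measurableSet_Iio, Ioi_inter_Iio, integral_const_mul, gammaProductCDF]

theorem radialMoment_indicator_Iio_expProductDensity {κ a : ℝ} (hκ : 0 < κ) (ha : 0 ≤ a) :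
    radialMoment ((Iio a).indicator fun r => expProductDensity n (κ * r ^ 2)) l =
      gammaProductCDF n l (κ * a ^ 2) *
        radialMoment (fun r => expProductDensity n (κ * r ^ 2)) l := by
  have hmem (z : ℂ) : κ * ‖z‖ ^ 2 ∈ Iio (κ * a ^ 2) ↔ ‖z‖ ∈ Iio a := by
    rw [mem_Iio, mem_Iio, mul_lt_mul_iff_right₀ hκ,
      pow_lt_pow_iff_left₀ (norm_nonneg z) ha two_ne_zero]
  have hindicator (z : ℂ) : (Iio a).indicator (fun r => expProductDensity n (κ * r ^ 2)) ‖z‖ =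
      (Iio (κ * a ^ 2)).indicator (expProductDensity n) (κ * ‖z‖ ^ 2) := by
    simp only [indicator, hmem]
  calc
    _ = radialMoment (fun r => (Iio (κ * a ^ 2)).indicator (expProductDensity n) (κ * r ^ 2))
          l := by
        simp only [radialMoment, hindicator]
    _ = (κ ^ (l + 1))⁻¹ * ((l.factorial : ℝ) ^ (n + 1) * gammaProductCDF n l (κ * a ^ 2)) := by
        rw [radialMoment_comp_mul_sq hκ, integral_pow_mul_indicator_Iio_expProductDensity]
    _ = gammaProductCDF n l (κ * a ^ 2) *
          radialMoment (fun r => expProductDensity n (κ * r ^ 2)) l := by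
        rw [radialMoment_comp_mul_sq hκ, integral_pow_mul_expProductDensity]
        ring

end ExpProductDensity

section ProductPotential

variable (σ : SymmetryClass) (n : ℕ) {N : ℕ}

theorem SymmetryClass.beta_pos : 0 < (σ.beta : ℝ) := by
  cases σ <;> simp [SymmetryClass.beta]

theorem pow_beta_mul_pos (hN : 1 ≤ N) : 0 < ((σ.beta : ℝ) / 2 * N) ^ n := by
  have hβ := σ.beta_pos
  have : (0 : ℝ) < N := Nat.cast_pos.2 hN
  positivity

theorem isRadialBoltzmannFactor_productPotential (hN : 1 ≤ N) :
    IsRadialBoltzmannFactor N (productPotential σ (n + 1) N)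
      fun r => expProductDensity n (((σ.beta : ℝ) / 2 * N) ^ (n + 1) * r ^ 2) where
  hasRadialMoments := hasRadialMoments_comp_mul_sq (pow_beta_mul_pos σ (n + 1) hN)
    (integrableOn_pow_mul_expProductDensity n)
  ae_eq := by
    filter_upwards [Measure.ae_ne areaMeasure (0 : ℂ)] with z hz
    have hx : 0 < ((σ.beta : ℝ) / 2 * N) ^ (n + 1) * ‖z‖ ^ 2 :=
      mul_pos (pow_beta_mul_pos σ (n + 1) hN) (by positivity)
    have hN0 : (N : ℝ) ≠ 0 := Nat.cast_ne_zero.2 (Nat.one_le_iff_ne_zero.1 hN)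
    rw [productPotential, meijerG_zero_eq_expProductDensity n hx, Complex.ofReal_re, ← mul_assoc,
      ← neg_mul, mul_neg, neg_neg, mul_one_div_cancel hN0, one_mul,
      Real.exp_log (expProductDensity_pos n hx)]

theorem pow_mul_sq_div_rpow (c T : ℝ) (m : ℕ) (hN : 1 ≤ N) :
    (c * N) ^ m * (T / (N : ℝ) ^ ((m : ℝ) / 2)) ^ 2 = c ^ m * T ^ 2 := by
  have hN0 : (0 : ℝ) < N := Nat.cast_pos.2 hN
  have hsq : ((N : ℝ) ^ ((m : ℝ) / 2)) ^ 2 = (N : ℝ) ^ m := by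
    rw [← Real.rpow_natCast, ← Real.rpow_mul hN0.le, Nat.cast_ofNat, div_mul_cancel₀ _ two_ne_zero,
      Real.rpow_natCast]
  rw [div_pow, hsq, mul_pow]
  field_simp

variable {a T x : ℝ}

theorem meanNumber_productPotential (ha : 0 < a) (hN : 1 ≤ N) :
    meanNumber σ N (productPotential σ (n + 1) N) a = ∑ j ∈ Finset.range N,
      gammaProductCDF n (σ.exponent j) (((σ.beta : ℝ) / 2 * N) ^ (n + 1) * a ^ 2) := by
  have hκ := pow_beta_mul_pos σ (n + 1) hN
  rw [Finset.sum_range]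
  exact (isRadialBoltzmannFactor_productPotential σ n hN).meanNumber_eq
    (p := fun j => ⟨_, gammaProductCDF_nonneg n _ _, gammaProductCDF_le_one n _ (by positivity)⟩)
    fun j => radialMoment_indicator_Iio_expProductDensity n _ hκ ha.le

theorem numberVariance_productPotential (ha : 0 < a) (hN : 1 ≤ N) :
    numberVariance σ N (productPotential σ (n + 1) N) a = ∑ j ∈ Finset.range N,
      gammaProductCDF n (σ.exponent j) (((σ.beta : ℝ) / 2 * N) ^ (n + 1) * a ^ 2) *
        (1 - gammaProductCDF n (σ.exponent j) (((σ.beta : ℝ) / 2 * N) ^ (n + 1) * a ^ 2)) := by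
  have hκ := pow_beta_mul_pos σ (n + 1) hN
  rw [Finset.sum_range]
  exact (isRadialBoltzmannFactor_productPotential σ n hN).numberVariance_eq
    (p := fun j => ⟨_, gammaProductCDF_nonneg n _ _, gammaProductCDF_le_one n _ (by positivity)⟩)
    fun j => radialMoment_indicator_Iio_expProductDensity n _ hκ ha.le

theorem summable_gammaProductCDF_exponent (hx : 0 < x) :
    Summable fun j => gammaProductCDF n (σ.exponent j) x :=
  (summable_gammaProductCDF n hx).comp_injective σ.exponent_injective

theorem summable_gammaProductCDF_exponent_mul_one_sub (hx : 0 < x) :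
    Summable fun j =>
      gammaProductCDF n (σ.exponent j) x * (1 - gammaProductCDF n (σ.exponent j) x) := by
  refine (summable_gammaProductCDF_exponent σ n hx).of_nonneg_of_le (fun j => ?_) fun j => ?_
  · exact mul_nonneg (gammaProductCDF_nonneg n _ x)
      (sub_nonneg.2 (gammaProductCDF_le_one n _ hx))
  · exact mul_le_of_le_one_right (gammaProductCDF_nonneg n _ x)
      (sub_le_self _ (gammaProductCDF_nonneg n _ x))

theorem tendsto_meanNumber_productPotential (hT : 0 < T) :
    Tendsto (fun N : ℕ => meanNumber σ N (productPotential σ (n + 1) N)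
        (T / (N : ℝ) ^ (((n + 1 : ℕ) : ℝ) / 2))) atTop
      (𝓝 (∑' j, gammaProductCDF n (σ.exponent j) (((σ.beta : ℝ) / 2) ^ (n + 1) * T ^ 2))) := by
  have hβ := σ.beta_pos
  refine (summable_gammaProductCDF_exponent σ n (by positivity)).hasSum.tendsto_sum_nat.congr' ?_
  filter_upwards [eventually_ge_atTop 1] with N hN
  have : (0 : ℝ) < N := Nat.cast_pos.2 hN
  rw [meanNumber_productPotential σ n (by positivity) hN, pow_mul_sq_div_rpow _ _ _ hN]

theorem tendsto_numberVariance_productPotential (hT : 0 < T) :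
    Tendsto (fun N : ℕ => numberVariance σ N (productPotential σ (n + 1) N)
        (T / (N : ℝ) ^ (((n + 1 : ℕ) : ℝ) / 2))) atTop
      (𝓝 (∑' j, gammaProductCDF n (σ.exponent j) (((σ.beta : ℝ) / 2) ^ (n + 1) * T ^ 2) *
        (1 - gammaProductCDF n (σ.exponent j) (((σ.beta : ℝ) / 2) ^ (n + 1) * T ^ 2)))) := by
  have hβ := σ.beta_pos
  refine (summable_gammaProductCDF_exponent_mul_one_sub σ n
    (by positivity)).hasSum.tendsto_sum_nat.congr' ?_
  filter_upwards [eventually_ge_atTop 1] with N hN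
  have : (0 : ℝ) < N := Nat.cast_pos.2 hN
  rw [numberVariance_productPotential σ n (by positivity) hN, pow_mul_sq_div_rpow _ _ _ hN]

theorem hasSum_meijerLower (hx : 0 < x) :
    HasSum (fun j : ℕ => 1 / ((σ.beta / 2 * (j + 1) - 1).factorial : ℂ) ^ (n + 1) *
        meijerLower (n + 1) (σ.beta / 2 * (j + 1)) x)
      ((∑' j, gammaProductCDF n (σ.exponent j) x : ℝ) : ℂ) := by
  refine (Complex.hasSum_ofReal.2 (summable_gammaProductCDF_exponent σ n hx).hasSum).congr_fun
    fun j => ?_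
  have hfact : ((σ.exponent j).factorial : ℂ) ≠ 0 := Nat.cast_ne_zero.2 (Nat.factorial_ne_zero _)
  rw [← SymmetryClass.exponent_add_one, Nat.add_sub_cancel, meijerLower_eq n _ hx]
  field_simp

theorem hasSum_meijerLower_mul_meijerUpper (hx : 0 < x) :
    HasSum (fun j : ℕ => 1 / ((σ.beta / 2 * (j + 1) - 1).factorial : ℂ) ^ (2 * (n + 1)) *
        meijerLower (n + 1) (σ.beta / 2 * (j + 1)) x *
        meijerUpper (n + 1) (σ.beta / 2 * (j + 1)) x)
      ((∑' j, gammaProductCDF n (σ.exponent j) x * (1 - gammaProductCDF n (σ.exponent j) x) : ℝ) :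
        ℂ) := by
  refine (Complex.hasSum_ofReal.2
    (summable_gammaProductCDF_exponent_mul_one_sub σ n hx).hasSum).congr_fun fun j => ?_
  have hfact : ((σ.exponent j).factorial : ℂ) ≠ 0 := Nat.cast_ne_zero.2 (Nat.factorial_ne_zero _)
  rw [← SymmetryClass.exponent_add_one, Nat.add_sub_cancel, meijerLower_eq n _ hx,
    meijerUpper_eq n _ hx]
  push_cast
  field_simp
  ring

end ProductPotential

end PlanarEnsemble

theorem mainTheorem5 (σ : PlanarEnsemble.SymmetryClass) (m : ℕ) (hm : 1 ≤ m)
    (T : ℝ) (hT : 0 < T) :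
    (∀ N : ℕ, 1 ≤ N → IsProbabilityMeasure
      (PlanarEnsemble.gibbsMeasure σ N (PlanarEnsemble.productPotential σ m N))) ∧
    (∃ E : ℝ,
      Tendsto (fun N : ℕ => PlanarEnsemble.meanNumber σ N
          (PlanarEnsemble.productPotential σ m N) (T / (N : ℝ) ^ ((m : ℝ) / 2)))
        atTop (𝓝 E) ∧
      HasSum (fun j : ℕ =>
          1 / ((Nat.factorial (σ.beta / 2 * (j + 1) - 1) : ℂ)) ^ m
            * PlanarEnsemble.meijerLower m (σ.beta / 2 * (j + 1))
                (((σ.beta : ℝ) / 2) ^ m * T ^ 2))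
        (E : ℂ)) ∧
    (∃ V : ℝ,
      Tendsto (fun N : ℕ => PlanarEnsemble.numberVariance σ N
          (PlanarEnsemble.productPotential σ m N) (T / (N : ℝ) ^ ((m : ℝ) / 2)))
        atTop (𝓝 V) ∧
      HasSum (fun j : ℕ =>
          1 / ((Nat.factorial (σ.beta / 2 * (j + 1) - 1) : ℂ)) ^ (2 * m)
            * PlanarEnsemble.meijerLower m (σ.beta / 2 * (j + 1))
                (((σ.beta : ℝ) / 2) ^ m * T ^ 2)
            * PlanarEnsemble.meijerUpper m (σ.beta / 2 * (j + 1))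
                (((σ.beta : ℝ) / 2) ^ m * T ^ 2))
        (V : ℂ)) := by
  obtain ⟨n, rfl⟩ := Nat.exists_eq_add_of_le' hm
  have hβ := σ.beta_pos
  have hx : 0 < ((σ.beta : ℝ) / 2) ^ (n + 1) * T ^ 2 := by positivity
  exact
    ⟨fun _ hN =>
        (PlanarEnsemble.isRadialBoltzmannFactor_productPotential
          σ n hN).isProbabilityMeasure_gibbsMeasure,
      ⟨_, PlanarEnsemble.tendsto_meanNumber_productPotential σ n hT,
        PlanarEnsemble.hasSum_meijerLower σ n hx⟩,
      ⟨_, PlanarEnsemble.tendsto_numberVariance_productPotential σ n hT,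
        PlanarEnsemble.hasSum_meijerLower_mul_meijerUpper σ n hx⟩⟩
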